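/- **Setting.** A secondary transmitter with $N$ antennas serves one active receiver with known channel $\mathbf h\in\mathbb C^N$, in the presence of idle receivers $k=1,\dots,K-1$ with channels $\mathbf g_k=\hat{\mathbf g}_k+\Delta\mathbf g_k$, $\|\Delta\mathbf g_k\|\le\varepsilon_k$ (this ball is $\Omega_k$), and primary receivers $j=1,\dots,J$ with channels $\mathbf l_j=\hat{\mathbf l}_j+\Delta\mathbf l_j$, $\|\Delta\mathbf l_j\|\le\upsilon_j$ (this ball is $\Psi_j$). Put $\mathbf H=\mathbf h\mathbf h^H$, $\mathbf G_k=\mathbf g_k\mathbf g_k^H$, $\mathbf L_j=\mathbf l_j\mathbf l_j^H$. The radii $\varepsilon_k,\upsilon_j$, the noise variances $\sigma_{\rm z}^2,\sigma_{{\rm z}_k}^2,\sigma_{\rm PU}^2$, the SINR levels $\Gamma_{\rm req},\Gamma_{{\rm tol}_k},\Gamma^{\rm PU}_{{\rm tol}_j}$ and the power $P_{\max}$ are positive, and $0\le\eta_k\le1$. **Problems.** A policy is a pair $(\mathbf w,\mathbf V)$ of a vector in $\mathbb C^N$ and a Hermitian $N\times N$ matrix; let $\mathrm{TP}=\|\mathbf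 w\|^2+\operatorname{Tr}\mathbf V$. The constraints are C1: $\frac{\mathbf w^H\mathbf H\mathbf w}{\operatorname{Tr}(\mathbf H\mathbf V)+\sigma_{\rm z}^2}\ge\Gamma_{\rm req}$; C2: $\max_{\Omega_k}\frac{\mathbf w^H\mathbf G_k\mathbf w}{\operatorname{Tr}(\mathbf G_k\mathbf V)+\sigma_{{\rm z}_k}^2}\le\Gamma_{{\rm tol}_k}$ for all $k$; C3: $\max_{\Psi_j}\frac{\mathbf w^H\mathbf L_j\mathbf w}{\operatorname{Tr}(\mathbf L_j\mathbf V)+\sigma_{\rm PU}^2}\le\Gamma^{\rm PU}_{{\rm tol}_j}$ for all $j$; C4: $\mathrm{TP}\le P_{\max}$; C5: $\mathbf V\succeq0$. Problem $p\in\{1,2,3\}$ minimizes $F_p$ subject to C1–C5, where $F_1=\max_{\Delta\mathbf g}\,-\frac{1}{\mathrm{TP}}\sum_k\eta_k\big(\mathbf w^H\mathbf G_k\mathbf w+\operatorname{Tr}(\mathbf G_k\mathbf V)\big)$, $F_2=\mathrm{TP}$, $F_3=\max_{\Delta\mathbf l}\frac{1}{\mathrm{TP}}\sum_j\big(\mathbf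 w^H\mathbf L_j\mathbf w+\operatorname{Tr}(\mathbf L_j\mathbf V)\big)$. Problem 4 minimizes $\max_i\lambda_i(F_i-F_i^*)/|F_i^*|$ subject to C1–C5, with given weights $\lambda_i$ and constants $F_i^*$; here and below $i$ ranges over the objectives that are kept. **Transformed problems.** With $\overline{\mathbf W}=\xi\mathbf w\mathbf w^H$, $\overline{\mathbf V}=\xi\mathbf V$, $\xi=1/\mathrm{TP}$, transformed Problem $p$ minimizes $\overline F_p$ over Hermitian $\overline{\mathbf W},\overline{\mathbf V}$ and real $\xi$, where $\overline F_1=\max_{\Delta\mathbf g}-\sum_k\eta_k\operatorname{Tr}(\mathbf G_k(\overline{\mathbf W}+\overline{\mathbf V}))$, $\overline F_2=1/\xi$, $\overline F_3=\max_{\Delta\mathbf l}\sum_j\operatorname{Tr}(\mathbf L_j(\overline{\mathbf W}+\overline{\mathbf V}))$, subject to $\frac{\operatorname{Tr}(\mathbf H\overline{\mathbf W})}{\operatorname{Tr}(\mathbf H\overline{\mathbf V})+\sigma_{\rm z}^2\xi}\ge\Gamma_{\rm req}$, $\max_{\Omega_k}\frac{\operatorname{Tr}(\mathbf G_k\overline{\mathbf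 W})}{\operatorname{Tr}(\mathbf G_k\overline{\mathbf V})+\sigma_{{\rm z}_k}^2\xi}\le\Gamma_{{\rm tol}_k}$, $\max_{\Psi_j}\frac{\operatorname{Tr}(\mathbf L_j\overline{\mathbf W})}{\operatorname{Tr}(\mathbf L_j\overline{\mathbf V})+\sigma_{\rm PU}^2\xi}\le\Gamma^{\rm PU}_{{\rm tol}_j}$, $\operatorname{Tr}\overline{\mathbf W}+\operatorname{Tr}\overline{\mathbf V}\le P_{\max}\xi$, $\overline{\mathbf W},\overline{\mathbf V}\succeq0$, $\xi\ge0$, $\operatorname{Tr}\overline{\mathbf W}+\operatorname{Tr}\overline{\mathbf V}=1$ and $\operatorname{rank}\overline{\mathbf W}=1$. Transformed Problem 4 minimizes $\tau$ subject to the same constraints and $\lambda_i(\overline F_i-F_i^*)/|F_i^*|\le\tau$ for every kept $i$. **The SDP.** For $\mathbf v\in\mathbb C^N$ let $\mathbf U_{\mathbf v}=[\mathbf I\ \ \mathbf v]$ and $\mathbf S(\mathbf v,r,\delta,s,\mathbf M)=\begin{bmatrix}\delta\mathbf I&\mathbf 0\\\mathbf 0&s-\delta r^2\end{bmatrix}+\mathbf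 U_{\mathbf v}^H\mathbf M\mathbf U_{\mathbf v}$. The rank-constrained program minimizes $\tau$ over $\overline{\mathbf W},\overline{\mathbf V},\xi,\tau$, real $E_k,I_j$ and nonnegative $\delta_k,\gamma_j,\varphi_k,\omega_j$. Its constraints are those of transformed Problem 4 with $\overline F_1,\overline F_3$ replaced by $\sum_kE_k,\sum_jI_j$ and with the two families of robust SINR constraints replaced by $\mathbf S(\hat{\mathbf g}_k,\varepsilon_k,\delta_k,\xi\sigma_{{\rm z}_k}^2,\overline{\mathbf V}-\overline{\mathbf W}/\Gamma_{{\rm tol}_k})\succeq0$ and $\mathbf S(\hat{\mathbf l}_j,\upsilon_j,\gamma_j,\xi\sigma_{\rm PU}^2,\overline{\mathbf V}-\overline{\mathbf W}/\Gamma^{\rm PU}_{{\rm tol}_j})\succeq0$, together with $\mathbf S(\hat{\mathbf g}_k,\varepsilon_k,\varphi_k,E_k,\eta_k(\overline{\mathbf W}+\overline{\mathbf V}))\succeq0$ and $\mathbf S(\hat{\mathbf l}_j,\upsilon_j,\omega_j,I_j,-(\overline{\mathbf W}+\overline{\mathbf V}))\succeq0$, for all $k,j$. The SDP relaxation drops $\operatorname{rank}\overline{\mathbf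 W}=1$. **Corollary 1.** Suppose that C1–C5 are feasible. Let $p\in\{1,2,3\}$, $\lambda_p=1$, $\lambda_i=0$ for $i\ne p$, and let $F_1^*,F_2^*,F_3^*$ be any finite constants with $F_p^*\neq0$ (for instance, any positive values). In Problem 4 and its transformed versions either discard the zero-weight objectives, or keep all three provided that $F_p^*\le F_p$ on the feasible set. Then: 1. The SDP relaxation has an optimal solution. 2. From every optimal solution $\Lambda^*$ of the relaxation, with matrices $\overline{\mathbf W}^*,\overline{\mathbf V}^*$ and value $\tau^*$, an optimal solution with a rank-one matrix is constructed as follows: there are $f>0$, a unit vector $\mathbf u$ and $\mathbf P\succeq0$ with $\mathbf H\mathbf P=\mathbf 0$ and $\overline{\mathbf W}^*=f\mathbf u\mathbf u^H+\mathbf P$; replace $\overline{\mathbf W}^*$ by $\widetilde{\mathbf W}=f\mathbf u\mathbf u^H$ and $\overline{\mathbf V}^*$ by $\widetilde{\mathbf V}=\overline{\mathbf V}^*+\mathbf P$ and keep all other variables. For all Lagrange multipliers satisfying the KKT conditions for $\overline{\mathbf W}^*$, that is, $\beta,\alpha\ge0$, $\mu\in\mathbb R$ and positive semidefinite $\mathbf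 Y,\mathbf D_{2,k},\mathbf D_{3,j},\mathbf D_{10,k},\mathbf D_{11,j}$ with $\mathbf Y\overline{\mathbf W}^*=\mathbf 0$ and $\mathbf Y+\beta\mathbf H=\mathbf A:=(\mu+\alpha)\mathbf I+\sum_k\mathbf U_{\hat{\mathbf g}_k}\big(\tfrac{\mathbf D_{2,k}}{\Gamma_{{\rm tol}_k}}-\eta_k\mathbf D_{10,k}\big)\mathbf U_{\hat{\mathbf g}_k}^H+\sum_j\mathbf U_{\hat{\mathbf l}_j}\big(\tfrac{\mathbf D_{3,j}}{\Gamma^{\rm PU}_{{\rm tol}_j}}+\mathbf D_{11,j}\big)\mathbf U_{\hat{\mathbf l}_j}^H$, this $\mathbf P$ equals $\sum_t\psi_t\boldsymbol\phi_t\boldsymbol\phi_t^H$ with $\psi_t\ge0$ and $(\boldsymbol\phi_t)$ an orthonormal basis of the null space of $\mathbf A$, and $\mathbf H\boldsymbol\phi_t=\mathbf 0$ for all $t$ if $\beta>0$. The constructed point is optimal for the relaxation and for the rank-constrained program; $(\widetilde{\mathbf W},\widetilde{\mathbf V},\xi)$ is a globally optimal solution of transformed Problem $p$, with optimal value $F_p^*+\tau^*|F_p^*|$;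 and $\widetilde{\mathbf W}=\xi\mathbf w\mathbf w^H$ for some $\mathbf w$ such that $(\mathbf w,\widetilde{\mathbf V}/\xi)$ is a globally optimal solution of Problem $p$, with the same value. 3. Transformed Problem $p$, transformed Problem 4 and the rank-constrained program have the same optimal $(\overline{\mathbf W},\overline{\mathbf V},\xi)$, and Problem $p$ and Problem 4 have the same optimal solutions. -/

import Mathlib

open Matrix
open scoped ComplexOrder

noncomputable section

namespace CRNetwork

/-- `a` solves the problem of minimizing `f` over `s`: it is feasible and globally optimal. -/
def Solves {α : Type*} (s : Set α) (f : α → ℝ) (a : α) : Prop :=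
  a ∈ s ∧ ∀ b ∈ s, f a ≤ f b

/-- The Hermitian rank-one matrix `v vᴴ`. -/
def outer {N : ℕ} (v : Fin N → ℂ) : Matrix (Fin N) (Fin N) ℂ := vecMulVec v (star v)

/-- The Hermitian form `wᴴ M w` (real for Hermitian `M`). -/
def quad {N : ℕ} (M : Matrix (Fin N) (Fin N) ℂ) (w : Fin N → ℂ) : ℝ := (star w ⬝ᵥ (M *ᵥ w)).re

/-- `Tr M` (real for all matrices to which it is applied below). -/
def tr {N : ℕ} (M : Matrix (Fin N) (Fin N) ℂ) : ℝ := M.trace.re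

/-- The channel uncertainty region `{d : dᴴ d ≤ r ^ 2}`. -/
def errBall (N : ℕ) (r : ℝ) : Set (Fin N → ℂ) := {d | (star d ⬝ᵥ d).re ≤ r ^ 2}

/-- The parameters of the system: a secondary transmitter with `N` antennas, one active and `K - 1`
idle secondary receivers, and `J` primary receivers. -/
structure Network (N K J : ℕ) where
  /-- channel of the active secondary receiver -/
  h : Fin N → ℂ
  /-- channel estimates of the idle receivers -/
  gHat : Fin (K - 1) → Fin N → ℂ
  /-- channel estimates of the primary receivers -/
  lHat : Fin J → Fin N → ℂ
  /-- radii of the uncertainty regions of the idle receivers -/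
  ε : Fin (K - 1) → ℝ
  /-- radii of the uncertainty regions of the primary receivers -/
  υ : Fin J → ℝ
  /-- energy conversion efficiencies -/
  η : Fin (K - 1) → ℝ
  /-- noise variance at the active receiver -/
  varZ : ℝ
  /-- noise variances at the idle receivers -/
  varIdle : Fin (K - 1) → ℝ
  /-- noise variance at the primary receivers -/
  varPU : ℝ
  /-- required SINR of the active receiver -/
  Γreq : ℝ
  /-- tolerable SINRs of the idle receivers -/
  Γtol : Fin (K - 1) → ℝ
  /-- tolerable SINRs of the primary receivers -/
  ΓPU : Fin J → ℝ
  /-- maximum transmit power -/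
  Pmax : ℝ
  ε_pos : ∀ k, 0 < ε k
  υ_pos : ∀ j, 0 < υ j
  η_nonneg : ∀ k, 0 ≤ η k
  η_le_one : ∀ k, η k ≤ 1
  varZ_pos : 0 < varZ
  varIdle_pos : ∀ k, 0 < varIdle k
  varPU_pos : 0 < varPU
  Γreq_pos : 0 < Γreq
  Γtol_pos : ∀ k, 0 < Γtol k
  ΓPU_pos : ∀ j, 0 < ΓPU j
  Pmax_pos : 0 < Pmax

namespace Network

variable {N K J : ℕ} (net : Network N K J)

/-- `H = h hᴴ` -/
def H : Matrix (Fin N) (Fin N) ℂ := outer net.h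

/-- `G_k = g_k g_kᴴ`, where `g_k` is the estimate plus the error `d`. -/
def G (k : Fin (K - 1)) (d : Fin N → ℂ) : Matrix (Fin N) (Fin N) ℂ := outer (net.gHat k + d)

/-- `L_j = l_j l_jᴴ`, where `l_j` is the estimate plus the error `d`. -/
def L (j : Fin J) (d : Fin N → ℂ) : Matrix (Fin N) (Fin N) ℂ := outer (net.lHat j + d)

/-- All joint channel errors of the idle receivers. -/
def Ω : Set (Fin (K - 1) → Fin N → ℂ) := {d | ∀ k, d k ∈ errBall N (net.ε k)}

/-- All joint channel errors of the primary receivers. -/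
def Ψ : Set (Fin J → Fin N → ℂ) := {d | ∀ j, d j ∈ errBall N (net.υ j)}

end Network

/-! ### The original problems -/

/-- A resource allocation policy: beamforming vector and artificial noise covariance. -/
structure Policy (N : ℕ) where
  w : Fin N → ℂ
  V : Matrix (Fin N) (Fin N) ℂ

/-- Total transmit power. -/
def TP {N : ℕ} (x : Policy N) : ℝ := (star x.w ⬝ᵥ x.w).re + tr x.V

namespace Network

variable {N K J : ℕ} (net : Network N K J)

/-- Total harvested power, for the channel errors `d`. -/
def HP (d : Fin (K - 1) → Fin N → ℂ) (x : Policy N) : ℝ :=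
  ∑ k, net.η k * (quad (net.G k (d k)) x.w + tr (net.G k (d k) * x.V))

/-- Total interference power leakage, for the channel errors `d`. -/
def IP (d : Fin J → Fin N → ℂ) (x : Policy N) : ℝ :=
  ∑ j, (quad (net.L j (d j)) x.w + tr (net.L j (d j) * x.V))

/-- Constraints C1 -- C5 of the original problems. -/
structure Feasible (x : Policy N) : Prop where
  C1 : net.Γreq ≤ quad net.H x.w / (tr (net.H * x.V) + net.varZ)
  C2 : ∀ k, ∀ d ∈ errBall N (net.ε k),
    quad (net.G k d) x.w / (tr (net.G k d * x.V) + net.varIdle k) ≤ net.Γtol k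
  C3 : ∀ j, ∀ d ∈ errBall N (net.υ j),
    quad (net.L j d) x.w / (tr (net.L j d * x.V) + net.varPU) ≤ net.ΓPU j
  C4 : TP x ≤ net.Pmax
  C5 : x.V.PosSemidef

/-- The objectives of Problems 1, 2, 3 (indexed by 0, 1, 2), all to be minimized: minus the
worst-case energy harvesting efficiency, the transmit power, and the worst-case
interference-leakage-to-transmit-power ratio. -/
def F : Fin 3 → Policy N → ℝ
  | 0, x => ⨆ d : net.Ω, -(net.HP d x / TP x)
  | 1, x => TP x
  | 2, x => ⨆ d : net.Ψ, net.IP d x / TP x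

/-- `x` solves Problem `p`. -/
def SolvesProblem (p : Fin 3) (x : Policy N) : Prop :=
  Solves {x | net.Feasible x} (net.F p) x

/-- `x` solves Problem 4 (weighted Tchebycheff method) with weights `lam` and constants `Fs`, the
maximum being taken over the objectives in `obj`. -/
def SolvesProblem4 (obj : Finset (Fin 3)) (lam Fs : Fin 3 → ℝ) (x : Policy N) : Prop :=
  Solves {x | net.Feasible x} (fun x => ⨆ i : obj, lam i * ((net.F i x - Fs i) / |Fs i|)) x

end Network

/-! ### The transformed problems -/

/-- The variables of the transformed problems (`W`, `V` stand for the matrices with a bar). -/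
structure TVar (N : ℕ) where
  W : Matrix (Fin N) (Fin N) ℂ
  V : Matrix (Fin N) (Fin N) ℂ
  ξ : ℝ

namespace Network

variable {N K J : ℕ} (net : Network N K J)

/-- Constraints C1 -- C8 of the transformed problems. -/
structure TFeasible (z : TVar N) : Prop where
  C1 : net.Γreq ≤ tr (net.H * z.W) / (tr (net.H * z.V) + net.varZ * z.ξ)
  C2 : ∀ k, ∀ d ∈ errBall N (net.ε k),
    tr (net.G k d * z.W) / (tr (net.G k d * z.V) + net.varIdle k * z.ξ) ≤ net.Γtol k
  C3 : ∀ j, ∀ d ∈ errBall N (net.υ j),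
    tr (net.L j d * z.W) / (tr (net.L j d * z.V) + net.varPU * z.ξ) ≤ net.ΓPU j
  C4 : tr z.W + tr z.V ≤ net.Pmax * z.ξ
  C5W : z.W.PosSemidef
  C5V : z.V.PosSemidef
  C6 : 0 ≤ z.ξ
  C7 : tr z.W + tr z.V = 1
  C8 : z.W.rank = 1

/-- The objectives of transformed Problems 1, 2, 3 (indexed by 0, 1, 2). -/
def TF : Fin 3 → TVar N → ℝ
  | 0, z => ⨆ d : net.Ω, -∑ k, net.η k * tr (net.G k (d.1 k) * (z.W + z.V))
  | 1, z => 1 / z.ξ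
  | 2, z => ⨆ d : net.Ψ, ∑ j, tr (net.L j (d.1 j) * (z.W + z.V))

/-- `z` solves transformed Problem `p`. -/
def SolvesTProblem (p : Fin 3) (z : TVar N) : Prop :=
  Solves {z | net.TFeasible z} (net.TF p) z

/-- `(z, τ)` solves transformed Problem 4, the epigraph form of Problem 4: minimize `τ` subject to
C1 -- C8 and, for the objectives in `obj`, C9. -/
def SolvesTProblem4 (obj : Finset (Fin 3)) (lam Fs : Fin 3 → ℝ) (z : TVar N) (τ : ℝ) : Prop :=
  Solves {y : TVar N × ℝ | net.TFeasible y.1 ∧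
    ∀ i ∈ obj, lam i / |Fs i| * (net.TF i y.1 - Fs i) ≤ y.2} (fun y => y.2) (z, τ)

end Network

/-! ### The semidefinite program -/

/-- The matrix `[I v]`. -/
def U {N : ℕ} (v : Fin N → ℂ) : Matrix (Fin N) (Fin N ⊕ Unit) ℂ :=
  fromCols 1 (replicateCol Unit v)

/-- The matrix of the S-procedure, `[δ I + M, M v; vᴴ M, s - δ r ^ 2 + vᴴ M v]`, which expresses
that `(v + d)ᴴ M (v + d) + s ≥ 0` whenever `dᴴ d ≤ r ^ 2`. -/
def lmi {N : ℕ} (v : Fin N → ℂ) (r δ s : ℝ) (M : Matrix (Fin N) (Fin N) ℂ) :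
    Matrix (Fin N ⊕ Unit) (Fin N ⊕ Unit) ℂ :=
  fromBlocks ((δ : ℂ) • 1) 0 0 (((s - δ * r ^ 2 : ℝ) : ℂ) • 1) + (U v)ᴴ * M * U v

/-- The variables of the semidefinite program. -/
structure SDPVar (N K J : ℕ) extends TVar N where
  τ : ℝ
  E : Fin (K - 1) → ℝ
  I : Fin J → ℝ
  δ : Fin (K - 1) → ℝ
  γ : Fin J → ℝ
  φ : Fin (K - 1) → ℝ
  ω : Fin J → ℝ

/-- The quantities that replace the objectives of transformed Problems 1, 2, 3 in C9. -/
def SDPVar.bound {N K J : ℕ} : Fin 3 → SDPVar N K J → ℝ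
  | 0, y => ∑ k, y.E k
  | 1, y => 1 / y.ξ
  | 2, y => ∑ j, y.I j

namespace Network

variable {N K J : ℕ} (net : Network N K J)

/-- The constraints of the SDP relaxation of transformed Problem 4: the robust constraints are
written as linear matrix inequalities, and the rank constraint C8 is dropped. In C10 the inequality
`-η_k (ĝ_k + d)ᴴ (W + V) (ĝ_k + d) ≤ E_k` is not divided by `η_k`, so that `η_k = 0` is allowed. -/
structure RelaxedFeasible (obj : Finset (Fin 3)) (lam Fs : Fin 3 → ℝ) (y : SDPVar N K J) :
    Prop where
  C1 : net.Γreq ≤ tr (net.H * y.W) / (tr (net.H * y.V) + net.varZ * y.ξ)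
  C2 : ∀ k, (lmi (net.gHat k) (net.ε k) (y.δ k) (y.ξ * net.varIdle k)
    (y.V - ((1 / net.Γtol k : ℝ) : ℂ) • y.W)).PosSemidef
  C3 : ∀ j, (lmi (net.lHat j) (net.υ j) (y.γ j) (y.ξ * net.varPU)
    (y.V - ((1 / net.ΓPU j : ℝ) : ℂ) • y.W)).PosSemidef
  C4 : tr y.W + tr y.V ≤ net.Pmax * y.ξ
  C5W : y.W.PosSemidef
  C5V : y.V.PosSemidef
  C6 : 0 ≤ y.ξ
  C7 : tr y.W + tr y.V = 1
  C9 : ∀ i ∈ obj, lam i * (SDPVar.bound i y - Fs i) ≤ y.τ * |Fs i|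
  C10 : ∀ k, (lmi (net.gHat k) (net.ε k) (y.φ k) (y.E k)
    ((net.η k : ℂ) • (y.W + y.V))).PosSemidef
  C11 : ∀ j, (lmi (net.lHat j) (net.υ j) (y.ω j) (y.I j) (-(y.W + y.V))).PosSemidef
  C12 : ∀ k, 0 ≤ y.δ k
  C13 : ∀ j, 0 ≤ y.γ j
  C14 : ∀ k, 0 ≤ y.φ k
  C15 : ∀ j, 0 ≤ y.ω j

/-- `y` solves the SDP relaxation of transformed Problem 4. -/
def SolvesRelaxed (obj : Finset (Fin 3)) (lam Fs : Fin 3 → ℝ) (y : SDPVar N K J) : Prop :=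
  Solves {y | net.RelaxedFeasible obj lam Fs y} SDPVar.τ y

/-- `y` solves the same program with the rank constraint C8. -/
def SolvesRankOne (obj : Finset (Fin 3)) (lam Fs : Fin 3 → ℝ) (y : SDPVar N K J) : Prop :=
  Solves {y | net.RelaxedFeasible obj lam Fs y ∧ y.W.rank = 1} SDPVar.τ y

end Network

/-! ### The construction of a rank-one solution -/

/-- Lagrange multipliers of the relaxed program: of C1, C4, C7, of `W ⪰ 0`, and of the matrix
inequalities C2, C3, C10, C11. -/
structure Multipliers (N K J : ℕ) where
  β : ℝ
  α : ℝ
  μ : ℝ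
  Y : Matrix (Fin N) (Fin N) ℂ
  D2 : Fin (K - 1) → Matrix (Fin N ⊕ Unit) (Fin N ⊕ Unit) ℂ
  D3 : Fin J → Matrix (Fin N ⊕ Unit) (Fin N ⊕ Unit) ℂ
  D10 : Fin (K - 1) → Matrix (Fin N ⊕ Unit) (Fin N ⊕ Unit) ℂ
  D11 : Fin J → Matrix (Fin N ⊕ Unit) (Fin N ⊕ Unit) ℂ

namespace Network

variable {N K J : ℕ} (net : Network N K J)

/-- The matrix `A` with `Y = A - β H` in the stationarity condition for `W`. -/
def A (m : Multipliers N K J) : Matrix (Fin N) (Fin N) ℂ :=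
  ((m.μ + m.α : ℝ) : ℂ) • 1
    + ∑ k, U (net.gHat k) *
        (((1 / net.Γtol k : ℝ) : ℂ) • m.D2 k - (net.η k : ℂ) • m.D10 k) * (U (net.gHat k))ᴴ
    + ∑ j, U (net.lHat j) * (((1 / net.ΓPU j : ℝ) : ℂ) • m.D3 j + m.D11 j) * (U (net.lHat j))ᴴ

/-- The Karush-Kuhn-Tucker conditions related to `W`: dual feasibility, complementary slackness,
and stationarity of the Lagrangian in `W`. -/
structure KKT (m : Multipliers N K J) (W : Matrix (Fin N) (Fin N) ℂ) : Prop where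
  β_nonneg : 0 ≤ m.β
  α_nonneg : 0 ≤ m.α
  Y_psd : m.Y.PosSemidef
  D2_psd : ∀ k, (m.D2 k).PosSemidef
  D3_psd : ∀ j, (m.D3 j).PosSemidef
  D10_psd : ∀ k, (m.D10 k).PosSemidef
  D11_psd : ∀ j, (m.D11 j).PosSemidef
  slack : m.Y * W = 0
  stationary : m.Y + (m.β : ℂ) • net.H = net.A m

/-- `y'` is constructed from `y` by splitting `W = f u uᴴ + P` with `f > 0`, `‖u‖ = 1`, `P ⪰ 0` and
`H P = 0`, keeping `f u uᴴ` as the new `W`, adding `P` to `V`, and leaving all other variables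
unchanged. Here, for all multipliers that satisfy the KKT conditions at `y`, the matrix `P` is a
nonnegative combination `∑ ψ_t φ_t φ_tᴴ` over an orthonormal basis `φ` of the null space of the
matrix `A`, and if the multiplier `β` of C1 is positive then `H φ_t = 0`. -/
def Constructed (y y' : SDPVar N K J) : Prop :=
  ∃ (f : ℝ) (u : Fin N → ℂ) (P : Matrix (Fin N) (Fin N) ℂ),
    0 < f ∧ star u ⬝ᵥ u = 1 ∧ P.PosSemidef ∧ net.H * P = 0 ∧
    y.W = (f : ℂ) • outer u + P ∧
    y' = { y with W := (f : ℂ) • outer u, V := y.V + P } ∧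
    ∀ m : Multipliers N K J, net.KKT m y.W →
      ∃ (φ : Fin (N - (net.A m).rank) → Fin N → ℂ) (ψ : Fin (N - (net.A m).rank) → ℝ),
        (∀ s t, star (φ s) ⬝ᵥ φ t = if s = t then 1 else 0) ∧
        (∀ t, net.A m *ᵥ φ t = 0) ∧
        (∀ t, 0 ≤ ψ t) ∧
        P = ∑ t, (ψ t : ℂ) • outer (φ t) ∧
        (0 < m.β → ∀ t, net.H *ᵥ φ t = 0)

end Network

end CRNetwork

end

/-! The rank constraint is inactive for an elementary reason. If `W` is positive semidefinite and `c
= hᴴ W h > 0`, then `P = W - (W h)(W h)ᴴ / c` is positive semidefinite and annihilates `h`, so `W -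
P` has rank one and delivers the same signal power at the active receiver. Moving `P` from `W` to
`V` leaves `W + V` unchanged, hence also the power, the harvesting and the leakage. It leaves C1
unchanged because `H P = 0`, and it only relaxes the robust SINR bounds, since signal becomes noise
there. C1 itself forces `c > 0`. Thus every feasible point of the relaxation gives a rank-one
feasible point with the same objectives (`exists_rankOne_splitting`, `RobustFeasible.split`), with
no appeal to duality. Multipliers enter only to describe `P`: since `P = W Q`, slackness `Y W = 0`
and `H P = 0` give `A P = 0`, and diagonalizing `P` on the null space of `A` yields the stated sum.

The rest identifies the programs with one another. The S-procedure turns each robust quadratic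
inequality into a matrix inequality without loss (`quad_nonneg_of_posSemidef_lmi`,
`exists_posSemidef_lmi`); its hard direction comes from the optimality conditions of a quadratic
minimum on a ball. Worst cases of different receivers are independent, so the slacks `E` and `I` can
reproduce the objectives exactly. The scaling `ξ = 1 / TP` relates original and transformed problems
(`change_of_variables`). With a single nonzero weight, the least admissible `τ` is an increasing
affine function of objective `p` (`solves_relaxedFeasible_iff`).

A minimizer exists because the feasible set is compact once the denominators are cleared, and the
objectives are lower semicontinuous on it (`exists_robustFeasible_min`). -/

namespace CRNetwork

/-! ### The real inner product and Hermitian forms -/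

/-- The real part of the standard inner product of complex vectors. -/
def rdot {n : Type*} [Fintype n] (x y : n → ℂ) : ℝ := (star x ⬝ᵥ y).re

section Forms

variable {n : Type*} [Fintype n]

theorem rdot_comm (x y : n → ℂ) : rdot x y = rdot y x := by
  unfold rdot
  rw [star_dotProduct, Complex.star_def, Complex.conj_re]

theorem rdot_add_right (x y z : n → ℂ) : rdot x (y + z) = rdot x y + rdot x z := by
  simp [rdot, dotProduct_add]

theorem rdot_add_left (x y z : n → ℂ) : rdot (x + y) z = rdot x z + rdot y z := by
  simp [rdot, add_dotProduct]

theorem rdot_smul_right (c : ℝ) (x y : n → ℂ) : rdot x ((c : ℂ) • y) = c * rdot x y := by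
  simp [rdot]

theorem rdot_smul_left (c : ℝ) (x y : n → ℂ) : rdot ((c : ℂ) • x) y = c * rdot x y := by
  simp [rdot]

theorem rdot_self_eq_sum (x : n → ℂ) : rdot x x = ∑ i, ‖x i‖ ^ 2 := by
  simp only [rdot, dotProduct, Complex.re_sum, Pi.star_apply]
  refine Finset.sum_congr rfl fun i _ => ?_
  rw [Complex.sq_norm, Complex.normSq_apply]
  simp

theorem rdot_self_nonneg (x : n → ℂ) : 0 ≤ rdot x x := by
  rw [rdot_self_eq_sum]; positivity

theorem eq_zero_of_rdot_self_eq_zero {x : n → ℂ} (h : rdot x x = 0) : x = 0 := by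
  rw [rdot_self_eq_sum, Finset.sum_eq_zero_iff_of_nonneg fun _ _ => by positivity] at h
  ext i
  simpa using h i (Finset.mem_univ i)

theorem rdot_mulVec_comm {M : Matrix n n ℂ} (hM : M.IsHermitian) (x y : n → ℂ) :
    rdot x (M *ᵥ y) = rdot y (M *ᵥ x) := by
  rw [rdot_comm]
  unfold rdot
  rw [star_mulVec, hM.eq, ← dotProduct_mulVec]

theorem posSemidef_iff_rdot {M : Matrix n n ℂ} :
    M.PosSemidef ↔ M.IsHermitian ∧ ∀ x, 0 ≤ rdot x (M *ᵥ x) := by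
  rw [posSemidef_iff_dotProduct_mulVec]
  refine and_congr_right fun hM => forall_congr' fun x => ?_
  rw [Complex.nonneg_iff]
  refine ⟨fun h => h.1, fun h => ⟨h, ?_⟩⟩
  simpa using (hM.im_star_dotProduct_mulVec_self x).symm

end Forms

section Quad

variable {N : ℕ}

theorem quad_eq_rdot (M : Matrix (Fin N) (Fin N) ℂ) (x : Fin N → ℂ) :
    quad M x = rdot x (M *ᵥ x) := rfl

theorem quad_add_vec {M : Matrix (Fin N) (Fin N) ℂ} (hM : M.IsHermitian) (x y : Fin N → ℂ) :
    quad M (x + y) = quad M x + 2 * rdot y (M *ᵥ x) + quad M y := by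
  simp only [quad_eq_rdot, mulVec_add, rdot_add_left, rdot_add_right]
  rw [rdot_mulVec_comm hM x y]; ring

theorem quad_smul_vec (M : Matrix (Fin N) (Fin N) ℂ) (c : ℂ) (x : Fin N → ℂ) :
    quad M (c • x) = Complex.normSq c * quad M x := by
  simp only [quad, mulVec_smul, star_smul, smul_dotProduct, dotProduct_smul, smul_eq_mul]
  rw [← mul_assoc, Complex.star_def, Complex.mul_conj, Complex.re_ofReal_mul]

theorem quad_add (M M' : Matrix (Fin N) (Fin N) ℂ) (x : Fin N → ℂ) :
    quad (M + M') x = quad M x + quad M' x := by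
  simp [quad, add_mulVec, dotProduct_add]

theorem quad_smul (c : ℝ) (M : Matrix (Fin N) (Fin N) ℂ) (x : Fin N → ℂ) :
    quad ((c : ℂ) • M) x = c * quad M x := by
  simp [quad, smul_mulVec]

theorem quad_neg (M : Matrix (Fin N) (Fin N) ℂ) (x : Fin N → ℂ) : quad (-M) x = -quad M x := by
  simp [quad, neg_mulVec]

theorem quad_sub (M M' : Matrix (Fin N) (Fin N) ℂ) (x : Fin N → ℂ) :
    quad (M - M') x = quad M x - quad M' x := by
  rw [sub_eq_add_neg, quad_add, quad_neg, sub_eq_add_neg]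

theorem quad_nonneg {M : Matrix (Fin N) (Fin N) ℂ} (hM : M.PosSemidef) (x : Fin N → ℂ) :
    0 ≤ quad M x := (posSemidef_iff_rdot.1 hM).2 x

theorem tr_outer_mul (v : Fin N → ℂ) (M : Matrix (Fin N) (Fin N) ℂ) :
    tr (outer v * M) = quad M v := by
  rw [tr, quad, outer, vecMulVec_mul, trace_vecMulVec, dotProduct_comm, ← dotProduct_mulVec]

theorem quad_outer (v w : Fin N → ℂ) : quad (outer v) w = quad (outer w) v := by
  rw [← tr_outer_mul, ← tr_outer_mul, tr, tr, trace_mul_comm]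

theorem tr_add (M M' : Matrix (Fin N) (Fin N) ℂ) : tr (M + M') = tr M + tr M' := by
  simp [tr]

theorem tr_smul (c : ℝ) (M : Matrix (Fin N) (Fin N) ℂ) : tr ((c : ℂ) • M) = c * tr M := by
  simp [tr, trace_smul]

theorem tr_outer (v : Fin N → ℂ) : tr (outer v) = rdot v v := by
  rw [tr, outer, trace_vecMulVec, dotProduct_comm]; rfl

end Quad

/-! ### The uncertainty region -/

theorem mem_errBall {N : ℕ} {r : ℝ} {d : Fin N → ℂ} : d ∈ errBall N r ↔ rdot d d ≤ r ^ 2 := Iff.rfl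

theorem zero_mem_errBall (N : ℕ) (r : ℝ) : (0 : Fin N → ℂ) ∈ errBall N r := by
  simp [errBall, sq_nonneg]

theorem isCompact_errBall (N : ℕ) (r : ℝ) : IsCompact (errBall N r) := by
  refine Metric.isCompact_of_isClosed_isBounded ?_ ?_
  · refine isClosed_le ?_ continuous_const
    fun_prop
  · refine (Metric.isBounded_closedBall (x := (0 : Fin N → ℂ)) (r := |r|)).subset fun d hd => ?_
    rw [mem_closedBall_zero_iff, pi_norm_le_iff_of_nonneg (abs_nonneg r)]
    intro i
    rw [mem_errBall, rdot_self_eq_sum] at hd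
    refine abs_le_of_sq_le_sq' ?_ (abs_nonneg r) |>.2
    rw [sq_abs]
    exact (Finset.single_le_sum (f := fun i => ‖d i‖ ^ 2) (fun _ _ => by positivity)
      (Finset.mem_univ i)).trans hd

/-! ### The S-procedure -/

section SProcedure

variable {N : ℕ}

theorem isHermitian_lmi (v : Fin N → ℂ) (r δ s : ℝ) {M : Matrix (Fin N) (Fin N) ℂ}
    (hM : M.IsHermitian) : (lmi v r δ s M).IsHermitian := by
  refine IsHermitian.add (IsHermitian.fromBlocks ?_ ?_ ?_) (isHermitian_conjTranspose_mul_mul _ hM)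
  · simp [IsHermitian, conjTranspose_smul]
  · simp
  · simp only [IsHermitian, conjTranspose_smul, conjTranspose_one, Complex.star_def,
      Complex.conj_ofReal]

/-- `U v` sends `(x, t)` to `x + t v`, so the matrix homogenizes the pair formed by the quadratic
inequality and the ball: at `t = 1` it gives the constraint plus `δ` times `‖x‖ ^ 2 - r ^ 2`. -/
theorem rdot_lmi (v : Fin N → ℂ) (r δ s : ℝ) (M : Matrix (Fin N) (Fin N) ℂ) (x : Fin N → ℂ)
    (t : ℂ) :
    rdot (Sum.elim x fun _ => t) (lmi v r δ s M *ᵥ Sum.elim x fun _ => t) =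
      δ * rdot x x + (s - δ * r ^ 2) * Complex.normSq t + quad M (x + t • v) := by
  have hU : U v *ᵥ (Sum.elim x fun _ => t) = x + t • v := by
    rw [U, fromCols_mulVec_sumElim, one_mulVec]
    congr 1
    ext i
    simp [mulVec, dotProduct, mul_comm]
  rw [lmi, add_mulVec, rdot_add_right]
  congr 1
  · rw [fromBlocks_mulVec]
    simp only [Sum.elim_comp_inl, Sum.elim_comp_inr, zero_mulVec, add_zero, zero_add, smul_mulVec,
      one_mulVec, rdot, dotProduct, Fintype.sum_sum_type, Sum.elim_inl, Sum.elim_inr,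
      Pi.star_apply, Pi.smul_apply, smul_eq_mul, Complex.add_re, Complex.re_sum]
    congr 1
    · rw [Finset.mul_sum]
      refine Finset.sum_congr rfl fun i _ => ?_
      rw [mul_left_comm, Complex.re_ofReal_mul]
    · rw [Finset.univ_unique, Finset.sum_singleton, mul_left_comm, Complex.re_ofReal_mul,
        Complex.star_def, mul_comm _ t, Complex.mul_conj, Complex.ofReal_re]
  · rw [← mulVec_mulVec, ← mulVec_mulVec, hU, quad, rdot, dotProduct_mulVec, ← star_mulVec, hU]

theorem posSemidef_lmi_iff {v : Fin N → ℂ} {r δ s : ℝ} {M : Matrix (Fin N) (Fin N) ℂ}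
    (hM : M.IsHermitian) :
    (lmi v r δ s M).PosSemidef ↔ ∀ (x : Fin N → ℂ) (t : ℂ),
      0 ≤ δ * rdot x x + (s - δ * r ^ 2) * Complex.normSq t + quad M (x + t • v) := by
  rw [posSemidef_iff_rdot]
  simp only [isHermitian_lmi v r δ s hM, true_and]
  refine ⟨fun h x t => rdot_lmi v r δ s M x t ▸ h _, fun h z => ?_⟩
  have hz : z = Sum.elim (fun i => z (Sum.inl i)) fun _ => z (Sum.inr ()) := by
    ext (i | i) <;> rfl
  rw [hz, rdot_lmi]
  exact h _ _

/-- The easy direction of the S-procedure. -/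
theorem quad_nonneg_of_posSemidef_lmi {v : Fin N → ℂ} {r δ s : ℝ} {M : Matrix (Fin N) (Fin N) ℂ}
    (hδ : 0 ≤ δ) (h : (lmi v r δ s M).PosSemidef) {d : Fin N → ℂ}
    (hd : d ∈ errBall N r) : 0 ≤ quad M (v + d) + s := by
  have h1 := (posSemidef_iff_rdot.1 h).2 (Sum.elim d fun _ => 1)
  rw [rdot_lmi, one_smul, map_one, add_comm d] at h1
  nlinarith [mul_le_mul_of_nonneg_left (mem_errBall.1 hd) hδ]

/-- Monotonicity in `M`: the same `δ` still certifies the inequality when noise is added to `V`. -/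
theorem posSemidef_lmi_add {v : Fin N → ℂ} {r δ s : ℝ} {M Q : Matrix (Fin N) (Fin N) ℂ}
    (h : (lmi v r δ s M).PosSemidef) (hQ : Q.PosSemidef) :
    (lmi v r δ s (M + Q)).PosSemidef := by
  have : lmi v r δ s (M + Q) = lmi v r δ s M + (U v)ᴴ * Q * U v := by
    simp only [lmi, Matrix.mul_add, Matrix.add_mul, add_assoc]
  rw [this]
  exact h.add (hQ.conjTranspose_mul_mul_same _)

/-- Let `s` tend to `0` from the right. This is the limiting step of the perturbation arguments
below. -/
theorem nonneg_of_forall_pos_polynomial {a b c ε : ℝ} (hε : 0 < ε)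
    (h : ∀ s, 0 < s → s < ε → 0 ≤ a + b * s + c * s ^ 2) : 0 ≤ a := by
  have h1 : Filter.Tendsto (fun s : ℝ => a + b * s + c * s ^ 2) (nhdsWithin 0 (Set.Ioi 0))
      (nhds (a + b * 0 + c * 0 ^ 2)) := by
    refine Filter.Tendsto.mono_left (Continuous.tendsto ?_ 0) nhdsWithin_le_nhds
    fun_prop
  have h2 := ge_of_tendsto h1 (b := 0) (by
    filter_upwards [Ioo_mem_nhdsGT hε] with s hs using h s hs.1 hs.2)
  simpa using h2

theorem rdot_add_smul_self (x e : Fin N → ℂ) (t : ℝ) :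
    rdot (x + (t : ℂ) • e) (x + (t : ℂ) • e) = rdot x x + 2 * t * rdot e x + t ^ 2 * rdot e e := by
  simp only [rdot_add_left, rdot_add_right, rdot_smul_left, rdot_smul_right]
  rw [rdot_comm x e]; ring

theorem quad_add_smul {M : Matrix (Fin N) (Fin N) ℂ} (hM : M.IsHermitian) (x e : Fin N → ℂ)
    (t : ℝ) :
    quad M (x + (t : ℂ) • e) = quad M x + 2 * t * rdot e (M *ᵥ x) + t ^ 2 * quad M e := by
  rw [quad_add_vec hM, rdot_smul_left, quad_smul_vec, Complex.normSq_ofReal]; ring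

/-- Optimality conditions for the minimum of a Hermitian quadratic function on a ball. -/
theorem exists_multiplier_of_isMin {M : Matrix (Fin N) (Fin N) ℂ} (hM : M.IsHermitian) {r : ℝ}
    (hr : 0 < r) {v d : Fin N → ℂ} (hd : d ∈ errBall N r)
    (hmin : ∀ e ∈ errBall N r, quad M (v + d) ≤ quad M (v + e)) :
    ∃ δ : ℝ, 0 ≤ δ ∧ δ * (rdot d d - r ^ 2) = 0 ∧ M *ᵥ (v + d) = ((-δ : ℝ) : ℂ) • d ∧
      ∀ e, 0 ≤ quad M e + δ * rdot e e := by
  set g := M *ᵥ (v + d) with hg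
  have hstep : ∀ (e : Fin N → ℂ) (t : ℝ),
      rdot d d + 2 * t * rdot e d + t ^ 2 * rdot e e ≤ r ^ 2 →
      0 ≤ 2 * t * rdot e g + t ^ 2 * quad M e := by
    intro e t ht
    have := hmin (d + (t : ℂ) • e) (by rw [mem_errBall, rdot_add_smul_self]; exact ht)
    rw [← add_assoc, quad_add_smul hM] at this
    linarith
  -- Directions that stay in the ball for small steps have a nonnegative directional derivative:
  -- divide `hstep` by `t` and let `t` tend to `0`.
  have hfirst : ∀ e, (2 * rdot e d < 0 ∨ rdot d d < r ^ 2) → 0 ≤ rdot e g := by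
    intro e he
    have hsmall : ∀ᶠ t in nhdsWithin (0 : ℝ) (Set.Ioi 0),
        rdot d d + 2 * t * rdot e d + t ^ 2 * rdot e e ≤ r ^ 2 := by
      rcases he with he | he
      · have : Filter.Tendsto (fun t : ℝ => 2 * rdot e d + t * rdot e e)
            (nhdsWithin 0 (Set.Ioi 0)) (nhds (2 * rdot e d + 0 * rdot e e)) := by
          refine Filter.Tendsto.mono_left (Continuous.tendsto ?_ 0) nhdsWithin_le_nhds
          fun_prop
        filter_upwards [this.eventually_lt_const (by simpa using he), self_mem_nhdsWithin]
          with t ht ht0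
        have h1 := mem_errBall.1 hd
        have h2 := mul_neg_of_pos_of_neg (Set.mem_Ioi.1 ht0) ht
        nlinarith
      · have : Filter.Tendsto (fun t : ℝ => rdot d d + 2 * t * rdot e d + t ^ 2 * rdot e e)
            (nhdsWithin 0 (Set.Ioi 0))
            (nhds (rdot d d + 2 * 0 * rdot e d + 0 ^ 2 * rdot e e)) := by
          refine Filter.Tendsto.mono_left (Continuous.tendsto ?_ 0) nhdsWithin_le_nhds
          fun_prop
        filter_upwards [this.eventually_lt_const (by simpa using he)] with t ht using ht.le
    obtain ⟨ε, hε, hsub⟩ := mem_nhdsGT_iff_exists_Ioo_subset.1 hsmall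
    have := nonneg_of_forall_pos_polynomial (a := 2 * rdot e g) (b := quad M e) (c := 0)
      (Set.mem_Ioi.1 hε) fun s hs hs' => by
        have h1 := hstep e s (hsub ⟨hs, hs'⟩)
        have h2 : 0 ≤ s * (2 * rdot e g + quad M e * s + 0 * s ^ 2) := by linarith
        exact nonneg_of_mul_nonneg_right h2 hs
    linarith
  rcases (mem_errBall.1 hd).lt_or_eq with hlt | heq
  · have hg0 : g = 0 := by
      refine eq_zero_of_rdot_self_eq_zero (le_antisymm ?_ (rdot_self_nonneg g))
      have := hfirst (((-1 : ℝ) : ℂ) • g) (Or.inr hlt)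
      rw [rdot_smul_left] at this
      linarith
    -- Interior minimum: the gradient vanishes and `δ = 0`; one admissible small step in direction
    -- `e` then shows `quad M e ≥ 0`.
    refine ⟨0, le_rfl, by simp, by simp [hg0], fun e => ?_⟩
    rw [zero_mul, add_zero]
    have hsmall : ∀ᶠ t in nhdsWithin (0 : ℝ) (Set.Ioi 0),
        rdot d d + 2 * t * rdot e d + t ^ 2 * rdot e e < r ^ 2 := by
      have : Filter.Tendsto (fun t : ℝ => rdot d d + 2 * t * rdot e d + t ^ 2 * rdot e e)
          (nhdsWithin 0 (Set.Ioi 0))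
          (nhds (rdot d d + 2 * 0 * rdot e d + 0 ^ 2 * rdot e e)) := by
        refine Filter.Tendsto.mono_left (Continuous.tendsto ?_ 0) nhdsWithin_le_nhds
        fun_prop
      exact this.eventually_lt_const (by simpa using hlt)
    obtain ⟨t, ht, ht0⟩ := (hsmall.and self_mem_nhdsWithin).exists
    have h1 := hstep e t ht.le
    have h2 : rdot e g = 0 := by simp [hg0, rdot]
    rw [h2, mul_zero, zero_add] at h1
    exact nonneg_of_mul_nonneg_right h1 (pow_pos (Set.mem_Ioi.1 ht0) 2)
  · have hr2 : 0 < r ^ 2 := by positivity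
    -- A tangential direction is a limit of strictly inward ones, obtained by subtracting `s d`.
    have hclosed : ∀ e, rdot e d ≤ 0 → 0 ≤ rdot e g := by
      intro e he
      refine nonneg_of_forall_pos_polynomial (a := rdot e g) (b := -rdot d g) (c := 0) one_pos
        fun s hs _ => ?_
      have := hfirst (e + ((-s : ℝ) : ℂ) • d) (Or.inl (by
        rw [rdot_add_left, rdot_smul_left, heq]
        nlinarith [mul_pos hs hr2]))
      rw [rdot_add_left, rdot_smul_left] at this
      linarith
    -- The value forced by pairing `g = -δ d` with `d`.
    set δ := -(rdot d g / r ^ 2) with hδ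
    have hδr : δ * r ^ 2 = -rdot d g := by rw [hδ]; field_simp
    have hδ0 : 0 ≤ δ := by
      have := hclosed (((-1 : ℝ) : ℂ) • d) (by rw [rdot_smul_left, heq]; linarith)
      rw [rdot_smul_left] at this
      refine nonneg_of_mul_nonneg_left (b := r ^ 2) ?_ hr2
      linarith
    have hgd : g = ((-δ : ℝ) : ℂ) • d := by
      -- The part of the gradient tangential to the sphere; moving along `-q` shows that it
      -- vanishes.
      set q := g + (δ : ℂ) • d with hq
      have hqd : rdot q d = 0 := by
        rw [hq, rdot_add_left, rdot_smul_left, heq, hδr, rdot_comm g d]; ring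
      have hqq : rdot q q = 0 := by
        refine le_antisymm ?_ (rdot_self_nonneg q)
        have := hclosed (((-1 : ℝ) : ℂ) • q) (by rw [rdot_smul_left, hqd]; simp)
        rw [rdot_smul_left] at this
        have h2 : rdot q q = rdot q g + δ * rdot q d := by
          nth_rewrite 2 [hq]
          rw [rdot_add_right, rdot_smul_right]
        rw [h2, hqd]; linarith
      have := eq_zero_of_rdot_self_eq_zero hqq
      rw [hq] at this
      rw [eq_neg_of_add_eq_zero_left this]
      simp
    refine ⟨δ, hδ0, by rw [heq]; ring, hgd, ?_⟩
    have hgen : ∀ e, rdot e d ≠ 0 → 0 ≤ quad M e + δ * rdot e e := by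
      intro e he
      have hee : 0 < rdot e e := by
        refine (rdot_self_nonneg e).lt_of_ne fun h => he ?_
        rw [eq_zero_of_rdot_self_eq_zero h.symm]
        simp [rdot]
      -- The second intersection of the line `d + t e` with the sphere. This finite step is
      -- feasible, and there `-2 t rdot e d = t ^ 2 rdot e e`, which turns the first-order term into
      -- the multiplier term.
      set t := -2 * rdot e d / rdot e e with ht
      have ht0 : t ≠ 0 := by
        rw [ht]; exact div_ne_zero (mul_ne_zero (by norm_num) he) hee.ne'
      have hte : t * rdot e e = -2 * rdot e d := by rw [ht]; field_simp
      have h1 := hstep e t (by rw [heq]; exact le_of_eq (by linear_combination t * hte))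
      rw [hgd, rdot_smul_right] at h1
      refine nonneg_of_mul_nonneg_right (a := t ^ 2) ?_ (by positivity)
      have : t ^ 2 * (quad M e + δ * rdot e e) = 2 * t * (-δ * rdot e d) + t ^ 2 * quad M e := by
        linear_combination t * δ * hte
      rw [this]; exact h1
    intro e
    -- Directions orthogonal to `d` follow by approximation with `e + s d`.
    by_cases he : rdot e d = 0
    · refine nonneg_of_forall_pos_polynomial (b := 2 * rdot d (M *ᵥ e) + 2 * δ * rdot d e)
        (c := quad M d + δ * rdot d d) one_pos fun s hs _ => ?_
      have := hgen (e + (s : ℂ) • d) (by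
        rw [rdot_add_left, rdot_smul_left, he, heq]; positivity)
      rw [quad_add_smul hM, rdot_add_smul_self] at this
      linarith
    · exact hgen e he

/-- The S-procedure is lossless. -/
theorem exists_posSemidef_lmi {M : Matrix (Fin N) (Fin N) ℂ} (hM : M.IsHermitian) {r s : ℝ}
    (hr : 0 < r) {v : Fin N → ℂ} (h : ∀ d ∈ errBall N r, 0 ≤ quad M (v + d) + s) :
    ∃ δ, 0 ≤ δ ∧ (lmi v r δ s M).PosSemidef := by
  obtain ⟨d, hd, hmin⟩ := (isCompact_errBall N r).exists_isMinOn ⟨0, zero_mem_errBall N r⟩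
    (f := fun d => quad M (v + d)) (Continuous.continuousOn (by unfold quad; fun_prop))
  obtain ⟨δ, hδ, hcs, hg, hpos⟩ := exists_multiplier_of_isMin hM hr hd hmin
  refine ⟨δ, hδ, (posSemidef_lmi_iff hM).2 fun x t => ?_⟩
  -- Centre `x` at the minimizer scaled by `t`. By stationarity the cross terms in `e` cancel; what
  -- remains is `|t| ^ 2` times the minimum value of the constraint, the curvature term in `e`, and
  -- a term killed by complementary slackness.
  obtain ⟨e, rfl⟩ : ∃ e, x = t • d + e := ⟨x - t • d, by abel⟩
  have h1 : t • d + e + t • v = t • (v + d) + e := by rw [smul_add]; abel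
  have h2 : rdot (t • d + e) (t • d + e) =
      Complex.normSq t * rdot d d + 2 * rdot e (t • d) + rdot e e := by
    have := quad_add_vec (M := (1 : Matrix (Fin N) (Fin N) ℂ)) isHermitian_one (t • d) e
    rw [quad_smul_vec] at this
    simpa only [quad_eq_rdot, one_mulVec] using this
  rw [h1, h2, quad_add_vec hM, quad_smul_vec, mulVec_smul, hg, smul_comm t, rdot_smul_right]
  have h3 := mul_nonneg (Complex.normSq_nonneg t) (h d hd)
  have h4 := hpos e
  have h5 : Complex.normSq t * (δ * (rdot d d - r ^ 2)) = 0 := by rw [hcs, mul_zero]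
  linarith

end SProcedure

/-! ### Suprema of separable functions over a product -/

section Separable

variable {ι X : Type*} [Fintype ι] {B : ι → Set X}

theorem iSup_sum_le_sum (hne : ∀ k, (B k).Nonempty) {f : ι → X → ℝ} {m : ι → ℝ}
    (h : ∀ k, ∀ d ∈ B k, f k d ≤ m k) :
    ⨆ d : {d : ι → X | ∀ k, d k ∈ B k}, ∑ k, f k (d.1 k) ≤ ∑ k, m k := by
  have : Nonempty {d : ι → X | ∀ k, d k ∈ B k} :=
    ⟨⟨fun k => (hne k).some, fun k => (hne k).some_mem⟩⟩
  exact ciSup_le fun d => Finset.sum_le_sum fun k _ => h k _ (d.2 k)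

theorem bddAbove_range_sum [TopologicalSpace X] (hB : ∀ k, IsCompact (B k)) {f : ι → X → ℝ}
    (hf : ∀ k, Continuous (f k)) :
    BddAbove (Set.range fun d : {d : ι → X | ∀ k, d k ∈ B k} => ∑ k, f k (d.1 k)) := by
  choose m hm using fun k => (hB k).bddAbove_image (hf k).continuousOn
  refine ⟨∑ k, m k, ?_⟩
  rintro _ ⟨d, rfl⟩
  exact Finset.sum_le_sum fun k _ => hm k (Set.mem_image_of_mem _ (d.2 k))

/-- The region is a product, so the maximizers of the individual terms form one admissible point
that maximizes the sum. -/
theorem exists_iSup_sum_eq [TopologicalSpace X] (hB : ∀ k, IsCompact (B k))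
    (hne : ∀ k, (B k).Nonempty) {f : ι → X → ℝ} (hf : ∀ k, Continuous (f k)) :
    ∃ m : ι → ℝ, (∀ k, ∀ d ∈ B k, f k d ≤ m k) ∧
      ⨆ d : {d : ι → X | ∀ k, d k ∈ B k}, ∑ k, f k (d.1 k) = ∑ k, m k := by
  choose e he hmax using fun k => (hB k).exists_isMaxOn (hne k) (hf k).continuousOn
  refine ⟨fun k => f k (e k), fun k d hd => hmax k hd, le_antisymm ?_ ?_⟩
  · exact iSup_sum_le_sum hne fun k d hd => hmax k hd
  · exact le_ciSup (bddAbove_range_sum hB hf) ⟨e, he⟩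

end Separable

theorem rank_eq_one_of_eq_smul_outer {N : ℕ} {M : Matrix (Fin N) (Fin N) ℂ} {c : ℂ}
    {v : Fin N → ℂ} (hM : M = c • outer v) (h0 : M ≠ 0) : M.rank = 1 := by
  refine le_antisymm ?_ (Nat.one_le_iff_ne_zero.2 fun h => h0 ?_)
  · rw [hM, outer, ← smul_vecMulVec]
    exact rank_vecMulVec_le _ _
  · rw [Matrix.rank, Submodule.finrank_eq_zero, LinearMap.range_eq_bot] at h
    exact ext_of_mulVec_single fun i => by
      rw [← mulVecLin_apply, h, LinearMap.zero_apply, zero_mulVec]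

/-! ### The transformed constraints without denominators -/

namespace Network

variable {N K J : ℕ} (net : Network N K J)

theorem tr_H_mul (M : Matrix (Fin N) (Fin N) ℂ) : tr (net.H * M) = quad M net.h :=
  tr_outer_mul _ _

theorem tr_G_mul (k : Fin (K - 1)) (d : Fin N → ℂ) (M : Matrix (Fin N) (Fin N) ℂ) :
    tr (net.G k d * M) = quad M (net.gHat k + d) := tr_outer_mul _ _

theorem tr_L_mul (j : Fin J) (d : Fin N → ℂ) (M : Matrix (Fin N) (Fin N) ℂ) :
    tr (net.L j d * M) = quad M (net.lHat j + d) := tr_outer_mul _ _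

/-- The constraints of the transformed problems without the rank constraint, with the fractional
constraints written as linear inequalities. -/
structure RobustFeasible (z : TVar N) : Prop where
  C1 : net.Γreq * (quad z.V net.h + net.varZ * z.ξ) ≤ quad z.W net.h
  C2 : ∀ k, ∀ d ∈ errBall N (net.ε k),
    0 ≤ quad (z.V - ((1 / net.Γtol k : ℝ) : ℂ) • z.W) (net.gHat k + d) + z.ξ * net.varIdle k
  C3 : ∀ j, ∀ d ∈ errBall N (net.υ j),
    0 ≤ quad (z.V - ((1 / net.ΓPU j : ℝ) : ℂ) • z.W) (net.lHat j + d) + z.ξ * net.varPU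
  C4 : tr z.W + tr z.V ≤ net.Pmax * z.ξ
  C5W : z.W.PosSemidef
  C5V : z.V.PosSemidef
  C6 : 0 ≤ z.ξ
  C7 : tr z.W + tr z.V = 1

variable {net}

/-- Normalized power one under the budget `Pmax * ξ` excludes `ξ ≤ 0`; this makes every SINR
denominator positive. -/
theorem pos_of_power {a ξ : ℝ} (h4 : a ≤ net.Pmax * ξ) (h7 : a = 1) : 0 < ξ := by
  by_contra! h
  have := mul_nonpos_of_nonneg_of_nonpos net.Pmax_pos.le h
  linarith

theorem RobustFeasible.ξ_pos {z : TVar N} (hz : net.RobustFeasible z) : 0 < z.ξ :=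
  pos_of_power hz.C4 hz.C7

theorem RobustFeasible.quad_h_pos {z : TVar N} (hz : net.RobustFeasible z) :
    0 < quad z.W net.h := by
  have h1 := quad_nonneg hz.C5V net.h
  have h2 := mul_pos net.varZ_pos hz.ξ_pos
  exact (mul_pos net.Γreq_pos (by linarith)).trans_le hz.C1

theorem le_div_add_iff {a b σ ξ Γ : ℝ} (hb : 0 ≤ b) (hσ : 0 < σ) (hξ : 0 < ξ) :
    Γ ≤ a / (b + σ * ξ) ↔ Γ * (b + σ * ξ) ≤ a :=
  le_div_iff₀ (by positivity)

/-- Multiplying out the positive denominator and dividing by `Γ` gives a quadratic form in the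
channel plus a constant, which is the input of the S-procedure. -/
theorem quad_div_le_iff {W V : Matrix (Fin N) (Fin N) ℂ} (hV : V.PosSemidef) {σ ξ Γ : ℝ}
    (hσ : 0 < σ) (hξ : 0 < ξ) (hΓ : 0 < Γ) (v : Fin N → ℂ) :
    quad W v / (quad V v + σ * ξ) ≤ Γ ↔ 0 ≤ quad (V - ((1 / Γ : ℝ) : ℂ) • W) v + ξ * σ := by
  have hV := quad_nonneg hV v
  rw [div_le_iff₀ (by positivity), quad_sub, quad_smul, ← div_le_iff₀' hΓ, one_div_mul_eq_div]
  constructor <;> intro h <;> linarith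

variable (net) in
theorem tFeasible_iff (z : TVar N) : net.TFeasible z ↔ net.RobustFeasible z ∧ z.W.rank = 1 := by
  have key (hξ : 0 < z.ξ) (hV : z.V.PosSemidef) :=
    And.intro (le_div_add_iff (a := quad z.W net.h) (Γ := net.Γreq) (quad_nonneg hV net.h)
      net.varZ_pos hξ) (And.intro
      (fun k v => quad_div_le_iff (W := z.W) hV (net.varIdle_pos k) hξ (net.Γtol_pos k) v)
      (fun j v => quad_div_le_iff (W := z.W) hV net.varPU_pos hξ (net.ΓPU_pos j) v))
  constructor
  · intro h
    obtain ⟨k1, k2, k3⟩ := key (pos_of_power h.C4 h.C7) h.C5V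
    refine ⟨⟨k1.1 ?_, fun k d hd => (k2 k _).1 ?_, fun j d hd => (k3 j _).1 ?_,
      h.C4, h.C5W, h.C5V, h.C6, h.C7⟩, h.C8⟩
    · simpa only [tr_H_mul] using h.C1
    · simpa only [tr_G_mul] using h.C2 k d hd
    · simpa only [tr_L_mul] using h.C3 j d hd
  · rintro ⟨h, h8⟩
    obtain ⟨k1, k2, k3⟩ := key h.ξ_pos h.C5V
    refine ⟨?_, fun k d hd => ?_, fun j d hd => ?_, h.C4, h.C5W, h.C5V, h.C6, h.C7, h8⟩
    · simpa only [tr_H_mul] using k1.2 h.C1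
    · simpa only [tr_G_mul] using (k2 k _).2 (h.C2 k d hd)
    · simpa only [tr_L_mul] using (k3 j _).2 (h.C3 j d hd)

/-! ### Comparison with the semidefinite program -/

variable (net) in
theorem TF_zero (z : TVar N) : net.TF 0 z =
    ⨆ d : net.Ω, ∑ k, -quad ((net.η k : ℂ) • (z.W + z.V)) (net.gHat k + d.1 k) := by
  simp only [TF, tr_G_mul, quad_smul, Finset.sum_neg_distrib]

variable (net) in
theorem TF_two (z : TVar N) : net.TF 2 z =
    ⨆ d : net.Ψ, ∑ j, quad (z.W + z.V) (net.lHat j + d.1 j) := by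
  simp only [TF, tr_L_mul]

theorem RelaxedFeasible.robustFeasible {obj : Finset (Fin 3)} {lam Fs : Fin 3 → ℝ}
    {y : SDPVar N K J} (h : net.RelaxedFeasible obj lam Fs y) : net.RobustFeasible y.toTVar where
  C1 := by
    have := h.C1
    rwa [tr_H_mul, tr_H_mul, le_div_add_iff (quad_nonneg h.C5V net.h) net.varZ_pos
      (pos_of_power h.C4 h.C7)] at this
  C2 k _ hd := quad_nonneg_of_posSemidef_lmi (h.C12 k) (h.C2 k) hd
  C3 j _ hd := quad_nonneg_of_posSemidef_lmi (h.C13 j) (h.C3 j) hd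
  C4 := h.C4
  C5W := h.C5W
  C5V := h.C5V
  C6 := h.C6
  C7 := h.C7

theorem RelaxedFeasible.TF_le_bound {obj : Finset (Fin 3)} {lam Fs : Fin 3 → ℝ}
    {y : SDPVar N K J} (h : net.RelaxedFeasible obj lam Fs y) (i : Fin 3) :
    net.TF i y.toTVar ≤ SDPVar.bound i y := by
  match i with
  | 0 =>
    rw [TF_zero]
    refine iSup_sum_le_sum (B := fun k => errBall N (net.ε k))
      (f := fun k d => -quad ((net.η k : ℂ) • (y.W + y.V)) (net.gHat k + d))
      (fun k => ⟨0, zero_mem_errBall _ _⟩) fun k d hd => ?_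
    have := quad_nonneg_of_posSemidef_lmi (h.C14 k) (h.C10 k) hd
    linarith
  | 1 => exact le_rfl
  | 2 =>
    rw [TF_two]
    refine iSup_sum_le_sum (B := fun j => errBall N (net.υ j))
      (f := fun j d => quad (y.W + y.V) (net.lHat j + d))
      (fun k => ⟨0, zero_mem_errBall _ _⟩) fun j d hd => ?_
    have := quad_nonneg_of_posSemidef_lmi (h.C15 j) (h.C11 j) hd
    rw [quad_neg] at this
    linarith

theorem continuous_quad_add (M : Matrix (Fin N) (Fin N) ℂ) (v : Fin N → ℂ) :
    Continuous fun d => quad M (v + d) := by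
  unfold quad
  fun_prop

theorem RobustFeasible.exists_relaxedFeasible {z : TVar N} (h : net.RobustFeasible z)
    {obj : Finset (Fin 3)} {lam Fs : Fin 3 → ℝ} {τ : ℝ}
    (hτ : ∀ i ∈ obj, lam i * (net.TF i z - Fs i) ≤ τ * |Fs i|) :
    ∃ y : SDPVar N K J, y.toTVar = z ∧ y.τ = τ ∧ net.RelaxedFeasible obj lam Fs y := by
  have hW := h.C5W.isHermitian
  have hV := h.C5V.isHermitian
  have hsmul (c : ℝ) {M : Matrix (Fin N) (Fin N) ℂ} (hM : M.IsHermitian) :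
      ((c : ℂ) • M).IsHermitian := by
    rw [IsHermitian, conjTranspose_smul, hM.eq, Complex.star_def, Complex.conj_ofReal]
  -- Taking each slack equal to the worst case of its own receiver makes the bounds in C9 equal to
  -- the objectives, not merely upper bounds.
  obtain ⟨E, hE, hEsum⟩ := exists_iSup_sum_eq (B := fun k => errBall N (net.ε k))
    (fun k => isCompact_errBall _ _) (fun k => ⟨0, zero_mem_errBall _ _⟩)
    (f := fun k d => -quad ((net.η k : ℂ) • (z.W + z.V)) (net.gHat k + d))
    (fun k => (continuous_quad_add _ _).neg)
  obtain ⟨I, hI, hIsum⟩ := exists_iSup_sum_eq (B := fun j => errBall N (net.υ j))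
    (fun k => isCompact_errBall _ _) (fun k => ⟨0, zero_mem_errBall _ _⟩)
    (f := fun j d => quad (z.W + z.V) (net.lHat j + d))
    (fun k => continuous_quad_add _ _)
  choose δ hδ hδ' using fun k => exists_posSemidef_lmi (hV.sub (hsmul (1 / net.Γtol k) hW))
    (net.ε_pos k) (h.C2 k)
  choose γ hγ hγ' using fun j => exists_posSemidef_lmi (hV.sub (hsmul (1 / net.ΓPU j) hW))
    (net.υ_pos j) (h.C3 j)
  choose φ hφ hφ' using fun k => exists_posSemidef_lmi (hsmul (net.η k) (hW.add hV))
    (net.ε_pos k) (v := net.gHat k) (s := E k) fun d hd => by have := hE k d hd; linarith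
  choose ω hω hω' using fun j => exists_posSemidef_lmi (hW.add hV).neg
    (net.υ_pos j) (v := net.lHat j) (s := I j) fun d hd => by
      have := hI j d hd; rw [quad_neg]; linarith
  have hbound (i : Fin 3) :
      SDPVar.bound i (⟨z, τ, E, I, δ, γ, φ, ω⟩ : SDPVar N K J) = net.TF i z := by
    match i with
    | 0 => rw [TF_zero]; exact hEsum.symm
    | 1 => rfl
    | 2 => rw [TF_two]; exact hIsum.symm
  refine ⟨⟨z, τ, E, I, δ, γ, φ, ω⟩, rfl, rfl, ?_, hδ', hγ', h.C4, h.C5W, h.C5V, h.C6, h.C7, ?_,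
    hφ', hω', hδ, hγ, hφ, hω⟩
  · rw [tr_H_mul, tr_H_mul, le_div_add_iff (quad_nonneg h.C5V net.h) net.varZ_pos h.ξ_pos]
    exact h.C1
  · intro i hi
    rw [hbound]
    exact hτ i hi

/-! ### Comparison with the original problems -/

/-- The change of variables turns the constraints and objectives of the original problems into those
of the transformed problems. -/
theorem change_of_variables {x : Policy N} {z : TVar N} (hξ : 0 < z.ξ)
    (hW : z.W = (z.ξ : ℂ) • outer x.w) (hV : z.V = (z.ξ : ℂ) • x.V) (hTP : z.ξ * TP x = 1) :
    (net.Feasible x ↔ net.TFeasible z) ∧ ∀ i, net.TF i z = net.F i x := by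
  have hTP' : TP x = 1 / z.ξ := by field_simp; linarith
  have trW (g : Fin N → ℂ) : tr (outer g * z.W) = z.ξ * quad (outer g) x.w := by
    rw [hW, tr_outer_mul, quad_smul, quad_outer]
  have trV (g : Fin N → ℂ) : tr (outer g * z.V) = z.ξ * tr (outer g * x.V) := by
    rw [hV, tr_outer_mul, tr_outer_mul, quad_smul]
  have ratio (g : Fin N → ℂ) (σ : ℝ) :
      tr (outer g * z.W) / (tr (outer g * z.V) + σ * z.ξ) =
        quad (outer g) x.w / (tr (outer g * x.V) + σ) := by
    rw [trW, trV, mul_comm σ, ← mul_add, mul_div_mul_left _ _ hξ.ne']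
  have trTP : tr z.W + tr z.V = z.ξ * TP x := by
    rw [hW, hV, tr_smul, tr_smul, tr_outer, TP, rdot]; ring
  refine ⟨⟨fun h => ?_, fun h => ?_⟩, fun i => ?_⟩
  · refine ⟨?_, ?_, ?_, ?_, ?_, ?_, hξ.le, ?_, ?_⟩
    · rw [H, ratio]; exact h.C1
    · intro k d hd; rw [G, ratio]; exact h.C2 k d hd
    · intro j d hd; rw [L, ratio]; exact h.C3 j d hd
    · rw [trTP, mul_comm]; exact mul_le_mul_of_nonneg_right h.C4 hξ.le
    · rw [hW]; exact (posSemidef_vecMulVec_self_star _).smul (by exact_mod_cast hξ.le)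
    · rw [hV]; exact h.C5.smul (by exact_mod_cast hξ.le)
    · rw [trTP, hTP]
    -- If `W` were zero, the SINR in C1 would be zero, below `Γreq > 0`.
    · refine rank_eq_one_of_eq_smul_outer hW fun h0 => ?_
      have h1 := h.C1
      rw [H, ← ratio, h0] at h1
      simp only [Matrix.mul_zero, tr, trace_zero, Complex.zero_re, zero_div] at h1
      exact h1.not_gt net.Γreq_pos
  · refine ⟨?_, ?_, ?_, ?_, ?_⟩
    · have := h.C1; rwa [H, ratio] at this
    · intro k d hd; have := h.C2 k d hd; rwa [G, ratio] at this
    · intro j d hd; have := h.C3 j d hd; rwa [L, ratio] at this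
    · have := h.C4
      rw [trTP, mul_comm] at this
      exact le_of_mul_le_mul_right this hξ
    · have hx : x.V = ((z.ξ⁻¹ : ℝ) : ℂ) • z.V := by
        rw [hV, smul_smul, ← Complex.ofReal_mul, inv_mul_cancel₀ hξ.ne', Complex.ofReal_one,
          one_smul]
      rw [hx]
      exact h.C5V.smul (by exact_mod_cast (inv_pos.2 hξ).le)
  · have hadd (g : Fin N → ℂ) : tr (outer g * (z.W + z.V)) =
        z.ξ * (quad (outer g) x.w + tr (outer g * x.V)) := by
      rw [Matrix.mul_add, tr_add, trW, trV, mul_add]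
    match i with
    | 0 =>
      refine congrArg iSup (funext fun d => ?_)
      simp only [HP, G, hadd]
      rw [hTP', div_div_eq_mul_div, div_one, Finset.sum_mul]
      congr 1
      exact Finset.sum_congr rfl fun k _ => by ring
    | 1 => exact hTP'.symm
    | 2 =>
      refine congrArg iSup (funext fun d => ?_)
      simp only [IP, L, hadd]
      rw [hTP', div_div_eq_mul_div, div_one, Finset.sum_mul]
      exact Finset.sum_congr rfl fun k _ => by ring

theorem Feasible.TP_pos {x : Policy N} (h : net.Feasible x) : 0 < TP x := by
  have hV : 0 ≤ tr x.V := (Complex.nonneg_iff.1 h.C5.trace_nonneg).1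
  refine add_pos_of_pos_of_nonneg ((rdot_self_nonneg x.w).lt_of_ne fun h0 => ?_) hV
  have h1 := h.C1
  rw [eq_zero_of_rdot_self_eq_zero h0.symm] at h1
  simp only [quad, mulVec_zero, dotProduct_zero, Complex.zero_re, zero_div] at h1
  exact h1.not_gt net.Γreq_pos

theorem Feasible.exists_tFeasible {x : Policy N} (h : net.Feasible x) :
    ∃ z, net.TFeasible z ∧ ∀ i, net.TF i z = net.F i x := by
  have hTP := h.TP_pos
  obtain ⟨h1, h2⟩ := change_of_variables (net := net) (x := x)
    (z := ⟨((1 / TP x : ℝ) : ℂ) • outer x.w, ((1 / TP x : ℝ) : ℂ) • x.V, 1 / TP x⟩)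
    (by positivity) rfl rfl (by field_simp)
  exact ⟨_, h1.1 h, h2⟩

theorem TFeasible.feasible_of_eq_outer {z : TVar N} (h : net.TFeasible z) {w : Fin N → ℂ}
    (hw : z.W = (z.ξ : ℂ) • outer w) :
    net.Feasible ⟨w, ((1 / z.ξ : ℝ) : ℂ) • z.V⟩ ∧
      ∀ i, net.F i ⟨w, ((1 / z.ξ : ℝ) : ℂ) • z.V⟩ = net.TF i z := by
  have hξ : 0 < z.ξ := pos_of_power h.C4 h.C7
  have hV : z.V = (z.ξ : ℂ) • (((1 / z.ξ : ℝ) : ℂ) • z.V) := by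
    rw [smul_smul, ← Complex.ofReal_mul, mul_one_div_cancel hξ.ne', Complex.ofReal_one, one_smul]
  obtain ⟨h1, h2⟩ := change_of_variables (net := net)
    (x := ⟨w, ((1 / z.ξ : ℝ) : ℂ) • z.V⟩) hξ hw hV (by
      -- The normalization C7 is exactly `ξ * TP = 1`.
      refine Eq.trans ?_ h.C7
      rw [hw, tr_smul, tr_outer, TP, tr_smul]
      simp only [rdot]
      field_simp)
  exact ⟨h1.2 h, fun i => (h2 i).symm⟩

end Network

/-! ### Splitting off a rank-one matrix -/

theorem outer_smul {N : ℕ} (c : ℝ) (v : Fin N → ℂ) :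
    outer ((c : ℂ) • v) = ((c ^ 2 : ℝ) : ℂ) • outer v := by
  simp only [outer, smul_vecMulVec, vecMulVec_smul, star_smul, smul_smul, Complex.star_def,
    Complex.conj_ofReal]
  push_cast
  rw [pow_two]

/-- A positive semidefinite `W` with `hᴴ W h > 0` is the sum of a rank-one matrix and a positive
semidefinite matrix that annihilates `h` and whose range is contained in that of `W`. -/
theorem exists_rankOne_splitting {N : ℕ} {W : Matrix (Fin N) (Fin N) ℂ} (hW : W.PosSemidef)
    {h : Fin N → ℂ} (hh : 0 < quad W h) :
    ∃ (f : ℝ) (u : Fin N → ℂ) (P Q : Matrix (Fin N) (Fin N) ℂ), 0 < f ∧ star u ⬝ᵥ u = 1 ∧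
      P.PosSemidef ∧ outer h * P = 0 ∧ P = W * Q ∧ W = (f : ℂ) • outer u + P := by
  set c := quad W h with hc
  have hcC : star h ⬝ᵥ (W *ᵥ h) = (c : ℂ) := by
    apply Complex.ext
    · rfl
    · simpa using hW.isHermitian.im_star_dotProduct_mulVec_self h
  have hc0 : (c : ℂ) ≠ 0 := by exact_mod_cast hh.ne'
  set R := outer h with hR
  have hRWR : R * W * R = (c : ℂ) • R := by
    rw [hR, outer, vecMulVec_mul, vecMulVec_mul_vecMulVec, ← dotProduct_mulVec, hcC,
      vecMulVec_smul]
  have hRH : R.IsHermitian := (posSemidef_vecMulVec_self_star h).isHermitian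
  -- With this `Q`, `W * Q = W - (W h)(W h)ᴴ / c`, and `R * W * Q = 0` because `R W R = c R`.
  set Q := (1 : Matrix (Fin N) (Fin N) ℂ) - (c : ℂ)⁻¹ • (R * W) with hQ
  have hQH : Qᴴ = 1 - (c : ℂ)⁻¹ • (W * R) := by
    rw [hQ, conjTranspose_sub, conjTranspose_one, conjTranspose_smul, conjTranspose_mul, hRH.eq,
      hW.isHermitian.eq, star_inv₀, Complex.star_def, Complex.conj_ofReal]
  have hRWQ : R * (W * Q) = 0 := by
    rw [hQ, Matrix.mul_sub, Matrix.mul_one, Matrix.mul_smul, Matrix.mul_sub, Matrix.mul_smul,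
      ← Matrix.mul_assoc, ← Matrix.mul_assoc, hRWR, Matrix.smul_mul, smul_smul,
      inv_mul_cancel₀ hc0, one_smul, sub_self]
  -- Since `R W Q = 0`, the correction in `Qᴴ` drops out and `Qᴴ W Q = W Q`.
  have hP : (W * Q).PosSemidef := by
    have h1 := hW.conjTranspose_mul_mul_same Q
    rwa [Matrix.mul_assoc, hQH, Matrix.sub_mul, Matrix.one_mul, Matrix.smul_mul, Matrix.mul_assoc,
      hRWQ, Matrix.mul_zero, smul_zero, sub_zero] at h1
  set g := W *ᵥ h with hg
  have hWR : W * (R * W) = outer g := by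
    rw [hR, outer, vecMulVec_mul, mul_vecMulVec, outer, hg, star_mulVec, hW.isHermitian.eq]
  have hgg : 0 < rdot g g := by
    refine (rdot_self_nonneg g).lt_of_ne fun h0 => hh.ne' ?_
    rw [hc, quad, ← hg, eq_zero_of_rdot_self_eq_zero h0.symm, dotProduct_zero, Complex.zero_re]
  set a := Real.sqrt (rdot g g) with ha
  have ha0 : 0 < a := Real.sqrt_pos.2 hgg
  have haa : a ^ 2 = rdot g g := Real.sq_sqrt hgg.le
  -- Normalization of `(W h)(W h)ᴴ / c`: the unit vector is `W h / a` with `a = ‖W h‖`.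
  refine ⟨a ^ 2 / c, ((a⁻¹ : ℝ) : ℂ) • g, W * Q, Q, by positivity, ?_, hP, hRWQ, rfl, ?_⟩
  · apply Complex.ext
    · have : rdot (((a⁻¹ : ℝ) : ℂ) • g) (((a⁻¹ : ℝ) : ℂ) • g) = 1 := by
        rw [rdot_smul_left, rdot_smul_right, ← haa]; field_simp
      exact this
    · simpa using isHermitian_one.im_star_dotProduct_mulVec_self (((a⁻¹ : ℝ) : ℂ) • g)
  · rw [outer_smul, smul_smul, ← Complex.ofReal_mul, hQ, Matrix.mul_sub, Matrix.mul_one,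
      Matrix.mul_smul, hWR]
    have : a ^ 2 / c * a⁻¹ ^ 2 = c⁻¹ := by field_simp
    rw [this, Complex.ofReal_inv, add_sub_cancel]

/-- A positive semidefinite matrix whose range lies in the null space of `A` is a nonnegative
combination of rank-one matrices over an orthonormal basis of that null space. -/
theorem exists_orthonormal_ker_decomposition {N : ℕ} {A P : Matrix (Fin N) (Fin N) ℂ}
    (hP : P.PosSemidef) (hAP : A * P = 0) :
    ∃ (φ : Fin (N - A.rank) → Fin N → ℂ) (ψ : Fin (N - A.rank) → ℝ),
      (∀ s t, star (φ s) ⬝ᵥ φ t = if s = t then 1 else 0) ∧ (∀ t, A *ᵥ φ t = 0) ∧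
      (∀ t, 0 ≤ ψ t) ∧ P = ∑ t, (ψ t : ℂ) • outer (φ t) := by
  have hvec (v : Fin N → ℂ) : star v ᵥ* P = star (P *ᵥ v) := by
    rw [star_mulVec, hP.isHermitian.eq]
  set S := LinearMap.ker (toEuclideanLin A) with hS
  have hmem (x : EuclideanSpace ℂ (Fin N)) : x ∈ S ↔ A *ᵥ x.ofLp = 0 := by
    rw [hS, LinearMap.mem_ker, toLpLin_apply, WithLp.toLp_eq_zero]
  have hdim : Module.finrank ℂ S = N - A.rank := by
    have h1 : Module.finrank ℂ (LinearMap.range (toEuclideanLin A)) + Module.finrank ℂ S = _ :=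
      LinearMap.finrank_range_add_finrank_ker (toEuclideanLin A)
    have h2 : A.rank = Module.finrank ℂ (LinearMap.range (toEuclideanLin A)) := by
      have h3 : toEuclideanLin A =
          toLin (PiLp.basisFun 2 ℂ (Fin N)) (PiLp.basisFun 2 ℂ (Fin N)) A := by
        rw [← toLpLin_eq_toLin]
      rw [h3]
      exact rank_eq_finrank_range_toLin _ _ _
    rw [finrank_euclideanSpace_fin, ← h2] at h1
    omega
  have hmaps (x : EuclideanSpace ℂ (Fin N)) : toEuclideanLin P x ∈ S := by
    rw [hmem, toLpLin_apply, mulVec_mulVec, hAP, zero_mulVec]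
  have hsym : (toEuclideanLin P).IsSymmetric := isSymmetric_toEuclideanLin_iff.2 hP.isHermitian
  -- As `A P = 0`, the range of `P` lies in the null space of `A`, so the spectral theorem applies
  -- to `P` restricted to that space.
  have hT := hsym.restrict_invariant (V := S) fun x _ => hmaps x
  set b := hT.eigenvectorBasis hdim with hb
  have hPb (t) : P *ᵥ (b t).1.ofLp = (hT.eigenvalues hdim t : ℂ) • (b t).1.ofLp := by
    have := congrArg (fun x : S => x.1.ofLp) (hT.apply_eigenvectorBasis hdim t)
    simpa [toLpLin_apply] using this
  have horth (s t) : star (b s).1.ofLp ⬝ᵥ (b t).1.ofLp = if s = t then 1 else 0 := by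
    have := orthonormal_iff_ite.1 b.orthonormal s t
    rwa [Submodule.coe_inner, EuclideanSpace.inner_eq_star_dotProduct, dotProduct_comm] at this
  refine ⟨fun t => (b t).1.ofLp, hT.eigenvalues hdim, horth, fun t => (hmem _).1 (b t).2,
    fun t => ?_, ?_⟩
  · have := (posSemidef_iff_rdot.1 hP).2 (b t).1.ofLp
    rw [hPb, rdot_smul_right, rdot, horth, if_pos rfl, Complex.one_re, mul_one] at this
    exact this
  · refine ext_of_mulVec_single fun i => ?_
    generalize (Pi.single i 1 : Fin N → ℂ) = x
    -- `P x` lies in the null space even when `x` does not, so it expands in `b`; self-adjointness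
    -- moves `P` onto the basis vectors.
    have h1 := b.sum_repr' ⟨toEuclideanLin P (WithLp.toLp 2 x), hmaps _⟩
    have h2 := congrArg (fun x : S => x.1.ofLp) h1
    simp only [Submodule.coe_inner, EuclideanSpace.inner_eq_star_dotProduct, toLpLin_apply,
      AddSubmonoidClass.coe_finsetSum, Submodule.coe_smul, WithLp.ofLp_sum, WithLp.ofLp_smul] at h2
    rw [← h2, sum_mulVec]
    refine Finset.sum_congr rfl fun t _ => ?_
    rw [smul_mulVec, outer, vecMulVec_mulVec, op_smul_eq_smul, smul_smul]
    congr 1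
    rw [dotProduct_comm, dotProduct_mulVec, hvec, hPb, star_smul,
      smul_dotProduct, Complex.star_def, Complex.conj_ofReal, smul_eq_mul]

/-! ### Multipliers and feasibility of the split point -/

namespace Network

variable {N K J : ℕ} {net : Network N K J}

/-- `A P = Y W Q + β H P = 0` by slackness and `H P = 0`. On the null space of `A`, the nonnegative
forms of `Y` and `β H` sum to zero, so each vanishes, and `β > 0` gives `H φ_t = 0`. -/
theorem KKT.exists_decomposition {m : Multipliers N K J} {W P Q : Matrix (Fin N) (Fin N) ℂ}
    (hm : net.KKT m W) (hP : P.PosSemidef) (hHP : net.H * P = 0) (hPQ : P = W * Q) :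
    ∃ (φ : Fin (N - (net.A m).rank) → Fin N → ℂ) (ψ : Fin (N - (net.A m).rank) → ℝ),
      (∀ s t, star (φ s) ⬝ᵥ φ t = if s = t then 1 else 0) ∧ (∀ t, net.A m *ᵥ φ t = 0) ∧
      (∀ t, 0 ≤ ψ t) ∧ P = ∑ t, (ψ t : ℂ) • outer (φ t) ∧
      (0 < m.β → ∀ t, net.H *ᵥ φ t = 0) := by
  have hAP : net.A m * P = 0 := by
    rw [← hm.stationary, Matrix.add_mul, Matrix.smul_mul, hHP, hPQ, ← Matrix.mul_assoc, hm.slack,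
      Matrix.zero_mul, smul_zero, add_zero]
  obtain ⟨φ, ψ, h1, h2, h3, h4⟩ := exists_orthonormal_ker_decomposition hP hAP
  refine ⟨φ, ψ, h1, h2, h3, h4, fun hβ t => ?_⟩
  have hH : net.H.PosSemidef := posSemidef_vecMulVec_self_star _
  have h5 : quad (net.A m) (φ t) = 0 := by rw [quad, h2 t, dotProduct_zero, Complex.zero_re]
  rw [← hm.stationary, quad_add, quad_smul] at h5
  have h6 := quad_nonneg hm.Y_psd (φ t)
  have h7 := quad_nonneg hH (φ t)
  have h8 : quad net.H (φ t) = 0 := by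
    refine le_antisymm ?_ h7
    by_contra! h9
    have := mul_pos hβ h9
    linarith
  rw [← hH.dotProduct_mulVec_zero_iff]
  apply Complex.ext
  · exact h8
  · simpa using hH.isHermitian.im_star_dotProduct_mulVec_self (φ t)

/-- Splitting off a rank-one matrix and adding the rest to the noise covariance preserves
feasibility. -/
theorem RobustFeasible.split {W V P : Matrix (Fin N) (Fin N) ℂ} {ξ f : ℝ} {u : Fin N → ℂ}
    (h : net.RobustFeasible ⟨W, V, ξ⟩) (hf : 0 < f) (hP : P.PosSemidef) (hHP : net.H * P = 0)
    (hW : W = (f : ℂ) • outer u + P) :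
    net.TFeasible ⟨(f : ℂ) • outer u, V + P, ξ⟩ ∧
      ∀ i, net.TF i ⟨(f : ℂ) • outer u, V + P, ξ⟩ = net.TF i ⟨W, V, ξ⟩ := by
  have hsum : (f : ℂ) • outer u + (V + P) = W + V := by rw [hW]; abel
  have hPh : quad P net.h = 0 := by rw [← tr_H_mul, hHP, tr, trace_zero, Complex.zero_re]
  have hquad : quad W net.h = quad ((f : ℂ) • outer u) net.h := by
    rw [hW, quad_add, hPh, add_zero]
  -- The left side grows by `(1 + 1 / Γ) * quad P v`, which is nonnegative.
  have hmono {Γ σ : ℝ} (hΓ : 0 < Γ) {v : Fin N → ℂ}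
      (hv : 0 ≤ quad (V - ((1 / Γ : ℝ) : ℂ) • W) v + σ) :
      0 ≤ quad (V + P - ((1 / Γ : ℝ) : ℂ) • (f : ℂ) • outer u) v + σ := by
    have h1 := quad_nonneg hP v
    have h2 := mul_nonneg (one_div_pos.2 hΓ).le h1
    rw [hW, quad_sub, quad_smul, quad_add] at hv
    rw [quad_sub, quad_smul, quad_add]
    linarith
  have htr : tr ((f : ℂ) • outer u) + tr (V + P) = tr W + tr V := by
    rw [← tr_add, hsum, tr_add]
  refine ⟨(net.tFeasible_iff _).2 ⟨⟨?_, fun k d hd => hmono (net.Γtol_pos k) (h.C2 k d hd),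
    fun j d hd => hmono (net.ΓPU_pos j) (h.C3 j d hd), htr.trans_le h.C4, ?_, h.C5V.add hP, h.C6,
    htr.trans h.C7⟩, ?_⟩, fun i => ?_⟩
  · have := h.C1
    simp only [hquad] at this
    simpa only [quad_add, hPh, add_zero] using this
  · exact (posSemidef_vecMulVec_self_star u).smul (by exact_mod_cast hf.le)
  · refine rank_eq_one_of_eq_smul_outer rfl fun h0 => h.quad_h_pos.ne' ?_
    rw [hquad]
    simp only at h0
    rw [h0, quad, zero_mulVec, dotProduct_zero, Complex.zero_re]
  · match i with
    | 0 => simp only [TF, hsum]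
    | 1 => rfl
    | 2 => simp only [TF, hsum]

end Network

/-! ### Existence of solutions -/

theorem norm_apply_le_one_of_tr_le_one {N : ℕ} {M : Matrix (Fin N) (Fin N) ℂ}
    (hM : M.PosSemidef) (htr : tr M ≤ 1) (i j : Fin N) : ‖M i j‖ ≤ 1 := by
  have hdiag (i : Fin N) : 0 ≤ (M i i).re ∧ (M i i).im = 0 := by
    have := Complex.nonneg_iff.1 (hM.diag_nonneg (i := i))
    exact ⟨this.1, this.2.symm⟩
  have hle (i : Fin N) : (M i i).re ≤ 1 := by
    refine le_trans ?_ htr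
    rw [tr, trace, Complex.re_sum]
    exact Finset.single_le_sum (f := fun i => (M.diag i).re) (fun i _ => (hdiag i).1)
      (Finset.mem_univ i)
  -- The `2 × 2` principal minor gives `|M i j| ^ 2 ≤ M i i * M j j`, and the trace bounds the
  -- diagonal entries.
  have hdet := (Complex.nonneg_iff.1 (hM.submatrix ![i, j]).det_nonneg).1
  have hji : M j i = star (M i j) := (hM.isHermitian.apply j i).symm
  rw [det_fin_two] at hdet
  simp only [submatrix_apply, cons_val_zero, cons_val_one, hji, Complex.star_def,
    Complex.mul_conj, Complex.sub_re, Complex.mul_re, Complex.ofReal_re, (hdiag i).2, zero_mul,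
    sub_zero] at hdet
  rw [← sq_le_one_iff₀ (norm_nonneg _), Complex.sq_norm]
  nlinarith [mul_le_mul (hle i) (hle j) (hdiag j).1 zero_le_one]

theorem isCompact_setOf_norm_apply_le_one (N : ℕ) :
    IsCompact {M : Matrix (Fin N) (Fin N) ℂ | ∀ i j, ‖M i j‖ ≤ 1} := by
  have hset : {M : Fin N → Fin N → ℂ | ∀ i j, ‖M i j‖ ≤ 1} =
      Set.univ.pi fun _ => Set.univ.pi fun _ => Metric.closedBall 0 1 := by
    ext M
    simp [Set.mem_pi]
  have h : IsCompact {M : Fin N → Fin N → ℂ | ∀ i j, ‖M i j‖ ≤ 1} := hset ▸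
    isCompact_univ_pi fun _ => isCompact_univ_pi fun _ => isCompact_closedBall _ _
  exact h

theorem isClosed_setOf_posSemidef {N : ℕ} :
    IsClosed {M : Matrix (Fin N) (Fin N) ℂ | M.PosSemidef} := by
  simp only [posSemidef_iff_rdot, Set.ofPred_and, Set.ofPred_forall]
  refine IsClosed.inter (isClosed_eq (by fun_prop) continuous_id) (isClosed_iInter fun x => ?_)
  refine isClosed_le continuous_const ?_
  unfold rdot
  fun_prop

namespace Network

variable {N K J : ℕ} (net : Network N K J)

theorem isClosed_robustFeasible :
    IsClosed {q : Matrix (Fin N) (Fin N) ℂ × Matrix (Fin N) (Fin N) ℂ × ℝ |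
      net.RobustFeasible ⟨q.1, q.2.1, q.2.2⟩} := by
  have hset : {q : Matrix (Fin N) (Fin N) ℂ × Matrix (Fin N) (Fin N) ℂ × ℝ |
      net.RobustFeasible ⟨q.1, q.2.1, q.2.2⟩} =
      {q | net.Γreq * (quad q.2.1 net.h + net.varZ * q.2.2) ≤ quad q.1 net.h} ∩
      ({q | ∀ k, ∀ d ∈ errBall N (net.ε k),
        0 ≤ quad (q.2.1 - ((1 / net.Γtol k : ℝ) : ℂ) • q.1) (net.gHat k + d)
          + q.2.2 * net.varIdle k} ∩
      ({q | ∀ j, ∀ d ∈ errBall N (net.υ j),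
        0 ≤ quad (q.2.1 - ((1 / net.ΓPU j : ℝ) : ℂ) • q.1) (net.lHat j + d)
          + q.2.2 * net.varPU} ∩
      ({q | tr q.1 + tr q.2.1 ≤ net.Pmax * q.2.2} ∩ ({q | q.1.PosSemidef} ∩
      ({q | q.2.1.PosSemidef} ∩ ({q | 0 ≤ q.2.2} ∩ {q | tr q.1 + tr q.2.1 = 1})))))) := by
    ext q
    exact ⟨fun h => ⟨h.C1, h.C2, h.C3, h.C4, h.C5W, h.C5V, h.C6, h.C7⟩,
      fun ⟨h1, h2, h3, h4, h5, h6, h7, h8⟩ => ⟨h1, h2, h3, h4, h5, h6, h7, h8⟩⟩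
  rw [hset]
  simp only [Set.ofPred_forall]
  refine IsClosed.inter (isClosed_le ?_ ?_) (IsClosed.inter
    (isClosed_iInter fun k => isClosed_iInter fun d => isClosed_iInter fun _ =>
      isClosed_le continuous_const ?_) (IsClosed.inter
    (isClosed_iInter fun k => isClosed_iInter fun d => isClosed_iInter fun _ =>
      isClosed_le continuous_const ?_) (IsClosed.inter (isClosed_le ?_ ?_) (IsClosed.inter
    (isClosed_setOf_posSemidef.preimage continuous_fst) (IsClosed.inter
    (isClosed_setOf_posSemidef.preimage (continuous_fst.comp continuous_snd)) (IsClosed.inter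
    (isClosed_le continuous_const (by fun_prop)) (isClosed_eq ?_ continuous_const)))))))
  all_goals first | fun_prop | (unfold quad; fun_prop) | (unfold tr; fun_prop)

/-- The trace normalization bounds the matrix entries. The variable `ξ` is bounded through C1,
because `Γreq * varZ * ξ` is at most the bounded signal power. -/
theorem isCompact_robustFeasible :
    IsCompact {q : Matrix (Fin N) (Fin N) ℂ × Matrix (Fin N) (Fin N) ℂ × ℝ |
      net.RobustFeasible ⟨q.1, q.2.1, q.2.2⟩} := by
  have hcpt := isCompact_setOf_norm_apply_le_one N
  obtain ⟨B, hB⟩ := hcpt.bddAbove_image (f := fun M => quad M net.h)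
    (Continuous.continuousOn (by unfold quad; fun_prop))
  have hbox := hcpt.prod (hcpt.prod (isCompact_Icc (a := 0) (b := B / (net.Γreq * net.varZ))))
  refine hbox.of_isClosed_subset net.isClosed_robustFeasible fun q hq => ?_
  have hW : 0 ≤ tr q.1 := (Complex.nonneg_iff.1 hq.C5W.trace_nonneg).1
  have hV : 0 ≤ tr q.2.1 := (Complex.nonneg_iff.1 hq.C5V.trace_nonneg).1
  have h7 := hq.C7
  simp only at h7
  have hmem := norm_apply_le_one_of_tr_le_one hq.C5W (by linarith)
  refine ⟨hmem, norm_apply_le_one_of_tr_le_one hq.C5V (by linarith), hq.C6, ?_⟩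
  rw [le_div_iff₀ (mul_pos net.Γreq_pos net.varZ_pos)]
  have h1 := hq.C1.trans (hB (Set.mem_image_of_mem _ hmem))
  have h2 := mul_nonneg net.Γreq_pos.le (quad_nonneg hq.C5V net.h)
  simp only at h1 h2
  linarith

/-- Objectives 0 and 2 are suprema of continuous functions; boundedness over the error region
matters because an unbounded real supremum takes the default value `0`. Objective 1 is continuous
since `ξ > 0` on the feasible set. -/
theorem lowerSemicontinuousOn_TF (p : Fin 3) :
    LowerSemicontinuousOn (fun q : Matrix (Fin N) (Fin N) ℂ × Matrix (Fin N) (Fin N) ℂ × ℝ =>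
      net.TF p ⟨q.1, q.2.1, q.2.2⟩) {q | net.RobustFeasible ⟨q.1, q.2.1, q.2.2⟩} := by
  match p with
  | 0 =>
    simp only [TF_zero]
    refine lowerSemicontinuousOn_ciSup (fun q _ => ?_) fun d =>
      (Continuous.continuousOn ?_).lowerSemicontinuousOn
    · exact bddAbove_range_sum (B := fun k => errBall N (net.ε k))
        (f := fun k d => -quad ((net.η k : ℂ) • (q.1 + q.2.1)) (net.gHat k + d))
        (fun k => isCompact_errBall _ _) fun k => (continuous_quad_add _ _).neg
    · unfold quad; fun_prop
  | 1 =>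
    refine ContinuousOn.lowerSemicontinuousOn (ContinuousOn.div continuousOn_const ?_ ?_)
    · exact (continuous_snd.comp continuous_snd).continuousOn
    · exact fun q hq => (RobustFeasible.ξ_pos hq).ne'
  | 2 =>
    simp only [TF_two]
    refine lowerSemicontinuousOn_ciSup (fun q _ => ?_) fun d =>
      (Continuous.continuousOn ?_).lowerSemicontinuousOn
    · exact bddAbove_range_sum (B := fun j => errBall N (net.υ j))
        (f := fun j d => quad (q.1 + q.2.1) (net.lHat j + d))
        (fun k => isCompact_errBall _ _) fun k => continuous_quad_add _ _
    · unfold quad; fun_prop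

theorem exists_robustFeasible_min (hne : ∃ z, net.RobustFeasible z) (p : Fin 3) :
    ∃ z, net.RobustFeasible z ∧ ∀ z', net.RobustFeasible z' → net.TF p z ≤ net.TF p z' := by
  obtain ⟨z₀, hz₀⟩ := hne
  obtain ⟨q, hq, hmin⟩ := (net.lowerSemicontinuousOn_TF p).exists_isMinOn
    ⟨(z₀.W, z₀.V, z₀.ξ), hz₀⟩ net.isCompact_robustFeasible
  exact ⟨⟨q.1, q.2.1, q.2.2⟩, hq, fun z' hz' => hmin (show (z'.W, z'.V, z'.ξ) ∈ _ from hz')⟩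

variable {net}

/-! ### Reduction to a single objective -/

theorem RobustFeasible.exists_splitting {z : TVar N} (h : net.RobustFeasible z) :
    ∃ (f : ℝ) (u : Fin N → ℂ) (P Q : Matrix (Fin N) (Fin N) ℂ), 0 < f ∧ star u ⬝ᵥ u = 1 ∧
      P.PosSemidef ∧ net.H * P = 0 ∧ P = z.W * Q ∧ z.W = (f : ℂ) • outer u + P :=
  exists_rankOne_splitting h.C5W h.quad_h_pos

theorem smul_outer_eq_smul_outer {f ξ : ℝ} (hf : 0 < f) (hξ : 0 < ξ) (u : Fin N → ℂ) :
    ∃ w, (f : ℂ) • outer u = (ξ : ℂ) • outer w := by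
  refine ⟨((Real.sqrt (f / ξ) : ℝ) : ℂ) • u, ?_⟩
  rw [outer_smul, smul_smul, ← Complex.ofReal_mul, Real.sq_sqrt (by positivity),
    mul_div_cancel₀ f hξ.ne']

/-- Every point feasible without the rank constraint is matched by an original policy. -/
theorem RobustFeasible.exists_feasible {z : TVar N} (h : net.RobustFeasible z) :
    ∃ x, net.Feasible x ∧ ∀ i, net.F i x = net.TF i z := by
  obtain ⟨f, u, P, Q, hf, -, hP, hHP, -, hW⟩ := h.exists_splitting
  obtain ⟨h1, h2⟩ := h.split hf hP hHP hW
  obtain ⟨w, hw⟩ := smul_outer_eq_smul_outer hf h.ξ_pos u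
  obtain ⟨h3, h4⟩ := h1.feasible_of_eq_outer hw
  exact ⟨_, h3, fun i => (h4 i).trans (h2 i)⟩

theorem RelaxedFeasible.split {obj : Finset (Fin 3)} {lam Fs : Fin 3 → ℝ} {y : SDPVar N K J}
    (h : net.RelaxedFeasible obj lam Fs y) {f : ℝ} {u : Fin N → ℂ}
    {P : Matrix (Fin N) (Fin N) ℂ} (hf : 0 < f) (hP : P.PosSemidef)
    (hHP : net.H * P = 0) (hW : y.W = (f : ℂ) • outer u + P) :
    net.RelaxedFeasible obj lam Fs { y with W := (f : ℂ) • outer u, V := y.V + P } := by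
  obtain ⟨ht, -⟩ := h.robustFeasible.split hf hP hHP hW
  have hsum : (f : ℂ) • outer u + (y.V + P) = y.W + y.V := by rw [hW]; abel
  have hlmi {Γ : ℝ} (hΓ : 0 < Γ) {v : Fin N → ℂ} {r δ s : ℝ}
      (h : (lmi v r δ s (y.V - ((1 / Γ : ℝ) : ℂ) • y.W)).PosSemidef) :
      (lmi v r δ s (y.V + P - ((1 / Γ : ℝ) : ℂ) • (f : ℂ) • outer u)).PosSemidef := by
    have hc : (0 : ℂ) ≤ ((1 / Γ : ℝ) : ℂ) := by exact_mod_cast (one_div_pos.2 hΓ).le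
    -- The matrix inside gains `P + P / Γ`; all S-procedure multipliers are kept.
    have h1 := posSemidef_lmi_add h (hP.add (hP.smul hc))
    rw [hW, smul_add] at h1
    convert h1 using 2
    abel
  refine ⟨ht.C1, fun k => hlmi (net.Γtol_pos k) (h.C2 k), fun j => hlmi (net.ΓPU_pos j) (h.C3 j),
    ht.C4, ht.C5W, ht.C5V, ht.C6, ht.C7, fun i hi => ?_, fun k => ?_, fun j => ?_,
    h.C12, h.C13, h.C14, h.C15⟩
  · have := h.C9 i hi
    match i with
    | 0 => exact this
    | 1 => exact this
    | 2 => exact this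
  · simp only [hsum]; exact h.C10 k
  · simp only [hsum]; exact h.C11 j

section SingleObjective

variable {p : Fin 3} {lam Fs : Fin 3 → ℝ} {obj : Finset (Fin 3)}

/-- The conditions on the weights, the constants and the objectives that are kept. -/
structure SingleObjective (net : Network N K J) (p : Fin 3) (lam Fs : Fin 3 → ℝ)
    (obj : Finset (Fin 3)) : Prop where
  lam_self : lam p = 1
  lam_ne : ∀ i, i ≠ p → lam i = 0
  ref_ne : Fs p ≠ 0
  obj_eq : obj = {p} ∨ (obj = Finset.univ ∧ ∀ x, net.Feasible x → Fs p ≤ net.F p x)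

theorem SingleObjective.mem (hs : SingleObjective net p lam Fs obj) : p ∈ obj := by
  rcases hs.obj_eq with rfl | ⟨rfl, -⟩ <;> simp

theorem SingleObjective.abs_pos (hs : SingleObjective net p lam Fs obj) : 0 < |Fs p| :=
  _root_.abs_pos.2 hs.ref_ne

/-- The constraints of the zero-weight objectives are implied by that of objective `p`. -/
theorem SingleObjective.constraints_iff (hs : SingleObjective net p lam Fs obj) {z : TVar N}
    (hz : net.RobustFeasible z) {τ : ℝ} {b : Fin 3 → ℝ} (hb : net.TF p z ≤ b p) :
    (∀ i ∈ obj, lam i * (b i - Fs i) ≤ τ * |Fs i|) ↔ b p ≤ Fs p + τ * |Fs p| := by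
  refine ⟨fun h => ?_, fun h i hi => ?_⟩
  · have := h p hs.mem
    rw [hs.lam_self] at this
    linarith
  · by_cases hip : i = p
    · subst hip; rw [hs.lam_self]; linarith
    · rw [hs.lam_ne i hip, zero_mul]
      rcases hs.obj_eq with rfl | ⟨-, hF⟩
      · exact absurd (Finset.mem_singleton.1 hi) hip
      -- A zero-weight constraint only asks for `0 ≤ τ * |Fs i|`. The lower bound `Fs p`,
      -- transferred from a matching original policy, forces `τ ≥ 0`.
      · obtain ⟨x, hx, hxF⟩ := hz.exists_feasible
        have := hF x hx
        rw [hxF] at this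
        refine mul_nonneg ?_ (abs_nonneg _)
        exact nonneg_of_mul_nonneg_left (b := |Fs p|) (by linarith) hs.abs_pos

theorem RelaxedFeasible.TF_le (hs : SingleObjective net p lam Fs obj) {y : SDPVar N K J}
    (h : net.RelaxedFeasible obj lam Fs y) : net.TF p y.toTVar ≤ Fs p + y.τ * |Fs p| :=
  (h.TF_le_bound p).trans ((hs.constraints_iff h.robustFeasible (h.TF_le_bound p)).1 h.C9)

/-- The choice of `τ` makes the constraint C9 of objective `p` tight. -/
theorem RobustFeasible.exists_relaxedFeasible_eq (hs : SingleObjective net p lam Fs obj)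
    {z : TVar N} (h : net.RobustFeasible z) :
    ∃ y : SDPVar N K J, y.toTVar = z ∧ net.RelaxedFeasible obj lam Fs y ∧
      net.TF p z = Fs p + y.τ * |Fs p| := by
  have hpos := hs.abs_pos
  have hτ : net.TF p z = Fs p + (net.TF p z - Fs p) / |Fs p| * |Fs p| := by
    field_simp
    ring
  obtain ⟨y, hyz, hyτ, hy⟩ := h.exists_relaxedFeasible (obj := obj) (lam := lam) (Fs := Fs)
    (τ := (net.TF p z - Fs p) / |Fs p|) <|
      (hs.constraints_iff h (b := fun i => net.TF i z) le_rfl).2 hτ.le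
  exact ⟨y, hyz, hy, hyτ ▸ hτ⟩

/-- Restricted to any set `S` of matrices and `ξ`, the semidefinite program minimizes `TF p`. -/
theorem solves_relaxedFeasible_iff (hs : SingleObjective net p lam Fs obj) (S : Set (TVar N))
    (y : SDPVar N K J) :
    Solves {y | net.RelaxedFeasible obj lam Fs y ∧ y.toTVar ∈ S} SDPVar.τ y ↔
      net.RelaxedFeasible obj lam Fs y ∧
      Solves {z | net.RobustFeasible z ∧ z ∈ S} (net.TF p) y.toTVar ∧
      net.TF p y.toTVar = Fs p + y.τ * |Fs p| := by
  have hpos := hs.abs_pos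
  constructor
  · rintro ⟨⟨h, hS⟩, hmin⟩
    have h1 : ∀ z, net.RobustFeasible z → z ∈ S → Fs p + y.τ * |Fs p| ≤ net.TF p z := by
      intro z hz hzS
      obtain ⟨y', rfl, hy', hτ⟩ := hz.exists_relaxedFeasible_eq hs
      rw [hτ]
      have := hmin y' ⟨hy', hzS⟩
      gcongr
    have h2 := h.TF_le hs
    exact ⟨h, ⟨⟨h.robustFeasible, hS⟩, fun z hz => h2.trans (h1 z hz.1 hz.2)⟩,
      h2.antisymm (h1 _ h.robustFeasible hS)⟩
  · rintro ⟨h, ⟨hy, hmin⟩, hτ⟩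
    refine ⟨⟨h, hy.2⟩, fun y' hy' => ?_⟩
    have h1 := (hmin _ ⟨hy'.1.robustFeasible, hy'.2⟩).trans (hy'.1.TF_le hs)
    rw [hτ] at h1
    exact le_of_mul_le_mul_right (by linarith) hpos

/-! ### Optimal solutions of the relaxation and equivalence of the programs -/

theorem solvesRelaxed_iff (hs : SingleObjective net p lam Fs obj) (y : SDPVar N K J) :
    net.SolvesRelaxed obj lam Fs y ↔ net.RelaxedFeasible obj lam Fs y ∧
      Solves {z | net.RobustFeasible z} (net.TF p) y.toTVar ∧
      net.TF p y.toTVar = Fs p + y.τ * |Fs p| := by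
  simpa [SolvesRelaxed] using solves_relaxedFeasible_iff hs Set.univ y

theorem solvesRankOne_iff (hs : SingleObjective net p lam Fs obj) (y : SDPVar N K J) :
    net.SolvesRankOne obj lam Fs y ↔ net.RelaxedFeasible obj lam Fs y ∧
      net.SolvesTProblem p y.toTVar ∧ net.TF p y.toTVar = Fs p + y.τ * |Fs p| := by
  simpa only [SolvesRankOne, SolvesTProblem, tFeasible_iff, Set.mem_ofPred_eq] using
    solves_relaxedFeasible_iff hs {z | z.W.rank = 1} y

theorem exists_solvesRelaxed (hs : SingleObjective net p lam Fs obj)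
    (hfeas : ∃ x, net.Feasible x) : ∃ y, net.SolvesRelaxed obj lam Fs y := by
  obtain ⟨x, hx⟩ := hfeas
  obtain ⟨z₀, hz₀, -⟩ := hx.exists_tFeasible
  obtain ⟨z, hz, hmin⟩ :=
    net.exists_robustFeasible_min ⟨z₀, ((net.tFeasible_iff z₀).1 hz₀).1⟩ p
  obtain ⟨y, rfl, hy, hτ⟩ := hz.exists_relaxedFeasible_eq hs
  exact ⟨y, (solvesRelaxed_iff hs y).2 ⟨hy, ⟨hz, hmin⟩, hτ⟩⟩

theorem SolvesRelaxed.exists_constructed (hs : SingleObjective net p lam Fs obj)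
    {y : SDPVar N K J} (h : net.SolvesRelaxed obj lam Fs y) :
    ∃ y', net.Constructed y y' ∧ y'.W.rank = 1 ∧ net.SolvesRelaxed obj lam Fs y' ∧
      net.SolvesRankOne obj lam Fs y' ∧ net.SolvesTProblem p y'.toTVar ∧
      net.TF p y'.toTVar = Fs p + y.τ * |Fs p| ∧
      ∃ w, y'.W = (y'.ξ : ℂ) • outer w ∧
        net.SolvesProblem p ⟨w, ((1 / y'.ξ : ℝ) : ℂ) • y'.V⟩ ∧
        net.F p ⟨w, ((1 / y'.ξ : ℝ) : ℂ) • y'.V⟩ = net.TF p y'.toTVar := by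
  obtain ⟨hy, hmin, hτ⟩ := (solvesRelaxed_iff hs y).1 h
  obtain ⟨f, u, P, Q, hf, hu, hP, hHP, hPQ, hW⟩ := hy.robustFeasible.exists_splitting
  obtain ⟨ht, hTF⟩ := hy.robustFeasible.split hf hP hHP hW
  have hval := (hTF p).trans hτ
  have hrob := ((net.tFeasible_iff _).1 ht).1
  -- The split point keeps a value that is minimal even without the rank constraint, hence it is
  -- minimal with it too.
  have hbest : ∀ z, net.RobustFeasible z → net.TF p _ ≤ net.TF p z := fun z hz =>
    (hTF p).trans_le (hmin.2 z hz)
  have hT : net.SolvesTProblem p ⟨(f : ℂ) • outer u, y.V + P, y.ξ⟩ :=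
    ⟨ht, fun z hz => hbest z ((net.tFeasible_iff z).1 hz).1⟩
  obtain ⟨w, hw⟩ := smul_outer_eq_smul_outer hf hy.robustFeasible.ξ_pos u
  obtain ⟨hx, hF⟩ := ht.feasible_of_eq_outer hw
  refine ⟨_, ⟨f, u, P, hf, hu, hP, hHP, hW, rfl, fun m hm =>
    hm.exists_decomposition hP hHP hPQ⟩, ht.C8,
    (solvesRelaxed_iff hs _).2 ⟨hy.split hf hP hHP hW, ⟨hrob, hbest⟩, hval⟩,
    (solvesRankOne_iff hs _).2 ⟨hy.split hf hP hHP hW, hT, hval⟩, hT, hval, w, hw,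
    ⟨hx, fun x' hx' => ?_⟩, hF p⟩
  -- A competing policy is scaled to a transformed feasible point with the same objectives.
  obtain ⟨z, hz, hzF⟩ := Feasible.exists_tFeasible (net := net) hx'
  rw [hF p, ← hzF p]
  exact hT.2 z hz

theorem solvesTProblem_iff_exists_solvesRankOne (hs : SingleObjective net p lam Fs obj)
    (z : TVar N) :
    net.SolvesTProblem p z ↔ ∃ y, net.SolvesRankOne obj lam Fs y ∧ y.toTVar = z := by
  constructor
  · intro h
    obtain ⟨y, rfl, hy, hτ⟩ := ((net.tFeasible_iff z).1 h.1).1.exists_relaxedFeasible_eq hs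
    exact ⟨y, (solvesRankOne_iff hs y).2 ⟨hy, h, hτ⟩, rfl⟩
  · rintro ⟨y, hy, rfl⟩
    exact ((solvesRankOne_iff hs y).1 hy).2.1

theorem solvesTProblem_iff_exists_solvesTProblem4 (hs : SingleObjective net p lam Fs obj)
    (z : TVar N) :
    net.SolvesTProblem p z ↔ ∃ τ, net.SolvesTProblem4 obj lam Fs z τ := by
  have hpos := hs.abs_pos
  -- At a feasible point the kept constraints amount to that of `p`: the others read `0 ≤ τ`, even
  -- when `Fs i = 0`, and the lower bound on objective `p` implies this.
  have key (z : TVar N) (hz : net.TFeasible z) (τ : ℝ) :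
      (∀ i ∈ obj, lam i / |Fs i| * (net.TF i z - Fs i) ≤ τ) ↔
        (net.TF p z - Fs p) / |Fs p| ≤ τ := by
    refine ⟨fun h => ?_, fun h i hi => ?_⟩
    · have := h p hs.mem
      rwa [hs.lam_self, one_div_mul_eq_div] at this
    · by_cases hip : i = p
      · subst hip; rwa [hs.lam_self, one_div_mul_eq_div]
      · rw [hs.lam_ne i hip, zero_div, zero_mul]
        rcases hs.obj_eq with rfl | ⟨-, hF⟩
        · exact absurd (Finset.mem_singleton.1 hi) hip
        · obtain ⟨x, hx, hxF⟩ := ((net.tFeasible_iff z).1 hz).1.exists_feasible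
          have := hF x hx
          rw [hxF] at this
          exact (div_nonneg (by linarith) hpos.le).trans h
  constructor
  · rintro ⟨hz, hmin⟩
    refine ⟨(net.TF p z - Fs p) / |Fs p|, ⟨hz, (key z hz _).2 le_rfl⟩, ?_⟩
    rintro ⟨z', τ'⟩ ⟨hz', hτ'⟩
    refine le_trans ?_ ((key z' hz' _).1 hτ')
    have : net.TF p z ≤ net.TF p z' := hmin z' hz'
    show (net.TF p z - Fs p) / |Fs p| ≤ _
    gcongr
  · rintro ⟨τ, ⟨hz, hτ⟩, hmin⟩
    refine ⟨hz, fun z' hz' => ?_⟩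
    have h1 := hmin (z', (net.TF p z' - Fs p) / |Fs p|) ⟨hz', (key z' hz' _).2 le_rfl⟩
    have h2 := ((key z hz _).1 hτ).trans h1
    rw [div_le_div_iff_of_pos_right hpos] at h2
    linarith

theorem solvesProblem_iff_solvesProblem4 (hs : SingleObjective net p lam Fs obj)
    (x : Policy N) : net.SolvesProblem p x ↔ net.SolvesProblem4 obj lam Fs x := by
  have hpos := hs.abs_pos
  -- The term of `p` attains the maximum: when other terms are kept they are zero and this one is
  -- nonnegative.
  have key (x : Policy N) (hx : net.Feasible x) :
      ⨆ i : obj, lam i * ((net.F i x - Fs i) / |Fs i|) = (net.F p x - Fs p) / |Fs p| := by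
    have : Nonempty obj := ⟨⟨p, hs.mem⟩⟩
    refine le_antisymm (ciSup_le fun i => ?_) ?_
    · by_cases hip : i.1 = p
      · rw [hip, hs.lam_self, one_mul]
      · rw [hs.lam_ne i hip, zero_mul]
        rcases hs.obj_eq with h | ⟨-, hF⟩
        · exact absurd (Finset.mem_singleton.1 (h ▸ i.2)) hip
        · exact div_nonneg (sub_nonneg.2 (hF x hx)) hpos.le
    · refine le_of_eq_of_le ?_ (le_ciSup (Set.finite_range _).bddAbove ⟨p, hs.mem⟩)
      rw [hs.lam_self, one_mul]
  refine and_congr_right fun hx => forall₂_congr fun x' hx' => ?_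
  simp only
  rw [key x hx, key x' hx', div_le_div_iff_of_pos_right hpos, sub_le_sub_iff_right]

end SingleObjective

end Network

end CRNetwork

theorem corollary1 {N K J : ℕ} (net : CRNetwork.Network N K J)
    (hfeas : ∃ x, net.Feasible x)
    (p : Fin 3) (lam Fs : Fin 3 → ℝ)
    (hlam : lam p = 1) (hlam0 : ∀ i, i ≠ p → lam i = 0) (hFs : Fs p ≠ 0)
    (obj : Finset (Fin 3))
    -- the zero-weight objectives are discarded, or all are kept and `Fs p` is a lower bound
    (hobj : obj = {p} ∨ (obj = Finset.univ ∧ ∀ x, net.Feasible x → Fs p ≤ net.F p x)) :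
    -- the SDP relaxation has an optimal solution
    (∃ y, net.SolvesRelaxed obj lam Fs y) ∧
    -- the construction turns every optimal solution of the relaxation into a rank-one optimal
    -- solution, which solves transformed Problem `p` and yields a solution of Problem `p`
    (∀ y, net.SolvesRelaxed obj lam Fs y → ∃ y', net.Constructed y y' ∧
      y'.W.rank = 1 ∧
      net.SolvesRelaxed obj lam Fs y' ∧
      net.SolvesRankOne obj lam Fs y' ∧
      net.SolvesTProblem p y'.toTVar ∧
      net.TF p y'.toTVar = Fs p + y.τ * |Fs p| ∧
      ∃ w, y'.W = (y'.ξ : ℂ) • CRNetwork.outer w ∧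
        net.SolvesProblem p ⟨w, ((1 / y'.ξ : ℝ) : ℂ) • y'.V⟩ ∧
        net.F p ⟨w, ((1 / y'.ξ : ℝ) : ℂ) • y'.V⟩ = net.TF p y'.toTVar) ∧
    -- transformed Problem `p`, transformed Problem 4 and the rank-constrained program share their
    -- solutions
    (∀ z, net.SolvesTProblem p z ↔ ∃ τ, net.SolvesTProblem4 obj lam Fs z τ) ∧
    (∀ z, net.SolvesTProblem p z ↔ ∃ y, net.SolvesRankOne obj lam Fs y ∧ y.toTVar = z) ∧
    -- so do the original Problem `p` and Problem 4
    (∀ x, net.SolvesProblem p x ↔ net.SolvesProblem4 obj lam Fs x) := by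
  have hs : net.SingleObjective p lam Fs obj := ⟨hlam, hlam0, hFs, hobj⟩
  exact ⟨CRNetwork.Network.exists_solvesRelaxed hs hfeas,
    fun _ hy => CRNetwork.Network.SolvesRelaxed.exists_constructed hs hy,
    CRNetwork.Network.solvesTProblem_iff_exists_solvesTProblem4 hs,
    CRNetwork.Network.solvesTProblem_iff_exists_solvesRankOne hs,
    CRNetwork.Network.solvesProblem_iff_solvesProblem4 hs⟩
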